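/- Let $B$ be a standard Brownian motion with almost surely continuous paths, let $S(u)=B(u+1)-B(u)$, $u\in[0,1]$, be the Slepian process, and let $m_s=\max_{0\le u\le s}S(u)$ and $M_t=\max_{0\le u\le t}S(u)$ be its running maxima. Let $0<s\le t\le 1$ and let $m\le M$ be real numbers. Put $$\overline s=\frac{s}{2-s},\quad T=\frac{t}{2-t},\quad p=\frac{\overline s-1}{2},\quad q=\frac{\overline s+1}{2}\,m,\quad \eta=\frac{\overline s+1}{2}\,M,\quad \delta=\sqrt{T-\overline s},$$ and let $\Phi$ be the distribution function of $N(0,1)$. Then $$\mathbb P(m_s\le m,\ M_t\le M)=\int_{-\infty}^{m}\int_{-\infty}^{px+q}\frac{1}{2\pi\sqrt{\overline s}}\,e^{-\frac{y^2}{2\overline s}}\,e^{-\frac{x^2}{2}}\Bigl\{1-e^{-\frac{(m-x)(px+q-y)}{\overline s}}\Bigr\}\,L(x,y)\,dy\,dx,$$ where, if $s<t$, $$L(x,y)=\Phi\Bigl(\frac{px+\eta-y}{\delta}+\frac{M+x}{2}\,\delta\Bigr)-e^{-(M+x)(px+\eta-y)}\,\Phi\Bigl(\frac{M+x}{2}\,\delta-\frac{px+\eta-y}{\delta}\Bigr),$$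 and, if $s=t$ (so that $\delta=0$), $L(x,y)=1$, which is the limit of the preceding expression as $\delta\downarrow 0$. The integrand is integrable over the region of integration. -/

import Mathlib

open MeasureTheory ProbabilityTheory
open scoped NNReal

noncomputable section

namespace Slepian

/-- The Slepian process `S(u) = B(u + 1) - B(u)` built from a process `B`. -/
def slepian {Ω : Type*} (B : ℝ≥0 → Ω → ℝ) (u : ℝ≥0) (ω : Ω) : ℝ :=
  B (u + 1) ω - B u ω

/-- The running maximum `max_{0 ≤ u ≤ s} S(u)` of the Slepian process. If the path of `B` is
continuous, then the supremum is taken over a nonempty compact set, so it is a maximum. -/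
def runningMax {Ω : Type*} (B : ℝ≥0 → Ω → ℝ) (s : ℝ≥0) (ω : Ω) : ℝ :=
  sSup ((fun u : ℝ≥0 => slepian B u ω) '' Set.Icc 0 s)

/-- The distribution function of the standard normal law `N(0, 1)`. -/
def Phi (x : ℝ) : ℝ := cdf (gaussianReal 0 1) x

/-- The finite-horizon Bachelier-Levy term with horizon `δ ^ 2`, intercept `a` and slope `c`,
for `a > 0`. For `δ = 0` it is the limit as `δ` decreases to `0`, which is `1`. -/
def bachelierLevy (a c δ : ℝ) : ℝ :=
  if δ = 0 then 1
  else Phi (a / δ + c * δ) - Real.exp (-(2 * c * a)) * Phi (c * δ - a / δ)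

/-- The integrand of the joint distribution function of the two running maxima. -/
def integrand (sbar p q η δ m M x y : ℝ) : ℝ :=
  1 / (2 * Real.pi * Real.sqrt sbar) * Real.exp (-(y ^ 2 / (2 * sbar))) * Real.exp (-(x ^ 2 / 2))
    * (1 - Real.exp (-((m - x) * (p * x + q - y) / sbar)))
    * bachelierLevy (p * x + η - y) ((M + x) / 2) δ

end Slepian

end

/-!
For a Brownian motion `B` and `τ ≤ 1`, the Slepian process `S` is Gaussian with
`cov (S u, S v) = 1 - |u - v|`. Removing from `S (2 τ / (1 + τ))` its regression on `S 0` and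
rescaling by `(1 + τ) / 2` leaves a Brownian motion `W` on `[0, 1]` which is independent of `S 0`.
Given `S 0 = x`, the condition `S ≤ m` up to a given time says that `W` stays below the line from
`(m - x) / 2` with slope `(m + x) / 2` up to the transformed time. The two maxima therefore give two
lines, the first in force up to time `σ` and the second from `σ` to `τ`.

By the Markov property at `σ`, the probability is an integral over `y = W σ` of the density of `W σ`
on the event that the first line is not crossed, times the Bachelier-Lévy probability that the
shifted motion stays below the second line. The density comes from a reflection principle with
drift: the heat evolution of `y ↦ g y - exp (2 c (y - b)) g (2 b - y)` vanishes along the line of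
slope `c` that ends at height `b` at time `σ`, so that the paths which cross this line contribute
nothing to its mean. If `g` vanishes above `b`, the other paths contribute the mean of `g (W σ)`.
-/

open Filter Topology

noncomputable section

namespace Slepian

section ContinuousPaths

variable {Ω α : Type*} [MeasurableSpace Ω] [MeasurableSpace α] {P : Measure Ω}

lemma aemeasurable_path {T E : Type*} [TopologicalSpace T] [TopologicalSpace.SeparableSpace T]
    [FrechetUrysohnSpace T] [Zero E] [TopologicalSpace E] [TopologicalSpace.PseudoMetrizableSpace E]
    [MeasurableSpace E] [BorelSpace E] {W : T → Ω → E} (hW : ∀ r, AEMeasurable (W r) P)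
    (hcont : ∀ᵐ ω ∂P, Continuous (W · ω)) : AEMeasurable (fun ω r => W r ω) P := by
  obtain ⟨D, hDc, hD⟩ := TopologicalSpace.exists_countable_dense T
  have hmk : ∀ᵐ ω ∂P, ∀ d ∈ D, W d ω = (hW d).mk (W d) ω :=
    (ae_ball_iff hDc).2 fun d _ => (hW d).ae_eq_mk
  obtain ⟨N, hN, hNm, hNW⟩ := (hcont.and hmk).exists_measurable_mem
  refine ⟨fun ω r => N.indicator (W r) ω, measurable_pi_lambda _ fun r => ?_, ?_⟩
  · obtain ⟨d, hdD, hd⟩ := mem_closure_iff_seq_limit.1 (hD r)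
    refine measurable_of_tendsto_metrizable (f := fun n => N.indicator ((hW (d n)).mk (W (d n))))
      (fun n => (hW (d n)).measurable_mk.indicator hNm) (tendsto_pi_nhds.2 fun ω => ?_)
    by_cases hω : ω ∈ N
    · simp only [Set.indicator_of_mem hω, ← (hNW ω hω).2 _ (hdD _)]
      exact ((hNW ω hω).1.tendsto r).comp hd
    · simp only [Set.indicator_of_notMem hω, tendsto_const_nhds]
  · filter_upwards [hN] with ω hω
    simp only [Set.indicator_of_mem hω]

lemma measure_prodMk_mem_of_indepFun [IsFiniteMeasure P] {β : Type*} [MeasurableSpace β]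
    {X : Ω → α} {Y : Ω → β} (hXY : IndepFun X Y P) (hX : AEMeasurable X P) (hY : AEMeasurable Y P)
    {S : Set (α × β)} (hS : MeasurableSet S) :
    P {ω | (X ω, Y ω) ∈ S} = ∫⁻ ω, P {ω' | (X ω, Y ω') ∈ S} ∂P := by
  have hsection : ∀ x, P {ω | (x, Y ω) ∈ S} = P.map Y (Prod.mk x ⁻¹' S) := fun x =>
    (Measure.map_apply_of_aemeasurable hY (measurable_prodMk_left hS)).symm
  calc P {ω | (X ω, Y ω) ∈ S}
    _ = P.map (fun ω => (X ω, Y ω)) S :=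
        (Measure.map_apply_of_aemeasurable (hX.prodMk hY) hS).symm
    _ = ∫⁻ x, P.map Y (Prod.mk x ⁻¹' S) ∂(P.map X) := by
        rw [(indepFun_iff_map_prod_eq_prod_map_map hX hY).1 hXY, Measure.prod_apply hS]
    _ = ∫⁻ ω, P {ω' | (X ω, Y ω') ∈ S} ∂P := by
        rw [lintegral_map' (measurable_measure_prodMk_left hS).aemeasurable hX]
        simp only [hsection]

/-- A set of pairs of a parameter and a path which, as far as continuous paths are concerned, is
measurable. The continuous paths themselves do not form a measurable subset of `ℝ≥0 → ℝ`. -/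
def MeasurableOnContinuous (S : Set (α × (ℝ≥0 → ℝ))) : Prop :=
  ∃ S', MeasurableSet S' ∧ ∀ x w, Continuous w → ((x, w) ∈ S ↔ (x, w) ∈ S')

namespace MeasurableOnContinuous

variable {S S' : Set (α × (ℝ≥0 → ℝ))}

lemma of_measurableSet (hS : MeasurableSet S) : MeasurableOnContinuous S :=
  ⟨S, hS, fun _ _ _ => Iff.rfl⟩

lemma inter (hS : MeasurableOnContinuous S) (hS' : MeasurableOnContinuous S') :
    MeasurableOnContinuous (S ∩ S') := by
  obtain ⟨A, hA, hSA⟩ := hS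
  obtain ⟨A', hA', hSA'⟩ := hS'
  exact ⟨A ∩ A', hA.inter hA', fun x w hw => and_congr (hSA x w hw) (hSA' x w hw)⟩

variable {X : Ω → α} {W : ℝ≥0 → Ω → ℝ}

lemma nullMeasurableSet_preimage (hS : MeasurableOnContinuous S) (hX : AEMeasurable X P)
    (hW : ∀ r, AEMeasurable (W r) P) (hcont : ∀ᵐ ω ∂P, Continuous (W · ω)) :
    NullMeasurableSet {ω | (X ω, (W · ω)) ∈ S} P := by
  obtain ⟨A, hA, hSA⟩ := hS
  refine ((hX.prodMk (aemeasurable_path hW hcont)).nullMeasurable hA).congr ?_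
  filter_upwards [hcont] with ω hω
  exact propext (hSA _ _ hω).symm

lemma measure_preimage_of_indepFun [IsFiniteMeasure P] (hS : MeasurableOnContinuous S)
    (hXW : IndepFun X (fun ω r => W r ω) P) (hX : AEMeasurable X P)
    (hW : ∀ r, AEMeasurable (W r) P) (hcont : ∀ᵐ ω ∂P, Continuous (W · ω)) :
    P {ω | (X ω, (W · ω)) ∈ S} = ∫⁻ ω, P {ω' | (X ω, (W · ω')) ∈ S} ∂P := by
  obtain ⟨A, hA, hSA⟩ := hS
  have hcongr : ∀ Y : Ω → α, P {ω | (Y ω, (W · ω)) ∈ S} = P {ω | (Y ω, (W · ω)) ∈ A} := fun Y =>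
    measure_congr <| by
      filter_upwards [hcont] with ω hω
      exact propext (hSA _ _ hω)
  rw [hcongr, measure_prodMk_mem_of_indepFun hXW hX (aemeasurable_path hW hcont) hA]
  exact lintegral_congr fun ω => (hcongr fun _ => X ω).symm

lemma measurable_measure_section [IsFiniteMeasure P] (hS : MeasurableOnContinuous S)
    (hW : ∀ r, AEMeasurable (W r) P) (hcont : ∀ᵐ ω ∂P, Continuous (W · ω)) :
    Measurable fun x => P {ω | (x, (W · ω)) ∈ S} := by
  obtain ⟨A, hA, hSA⟩ := hS
  convert measurable_measure_prodMk_left (ν := P.map fun ω r => W r ω) hA using 2 with x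
  rw [Measure.map_apply_of_aemeasurable (aemeasurable_path hW hcont) (measurable_prodMk_left hA)]
  refine measure_congr ?_
  filter_upwards [hcont] with ω hω
  exact propext (hSA _ _ hω)

end MeasurableOnContinuous

/-- The paths which stay below the line `r ↦ a + c * r` at all times in `I`. -/
def belowLine (I : Set ℝ≥0) (a c : ℝ) : Set (ℝ≥0 → ℝ) := {w | ∀ r ∈ I, w r ≤ a + c * r}

lemma belowLine_anti {D I : Set ℝ≥0} (h : D ⊆ I) (a c : ℝ) : belowLine I a c ⊆ belowLine D a c :=
  fun _ hw r hr => hw r (h hr)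

lemma mem_belowLine_of_subset_closure {D I : Set ℝ≥0} (hI : I ⊆ closure D) {a c : ℝ}
    {w : ℝ≥0 → ℝ} (hw : Continuous w) (h : w ∈ belowLine D a c) : w ∈ belowLine I a c := by
  have hclosed : IsClosed {r : ℝ≥0 | w r ≤ a + c * r} := isClosed_le hw (by fun_prop)
  exact fun r hr => closure_minimal h hclosed (hI hr)

lemma measurableOnContinuous_belowLine (I : Set ℝ≥0) {a c : α → ℝ} (ha : Measurable a)
    (hc : Measurable c) :
    MeasurableOnContinuous {z : α × (ℝ≥0 → ℝ) | z.2 ∈ belowLine I (a z.1) (c z.1)} := by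
  obtain ⟨D, hDI, hDc, hD⟩ :=
    (TopologicalSpace.IsSeparable.of_separableSpace I).exists_countable_dense_subset
  refine ⟨{z | z.2 ∈ belowLine D (a z.1) (c z.1)}, ?_, fun x w hw =>
    ⟨fun h => belowLine_anti hDI _ _ h, fun h => mem_belowLine_of_subset_closure hD hw h⟩⟩
  simp only [belowLine, Set.mem_ofPred_eq]
  simp only [Set.ofPred_forall]
  exact .biInter hDc fun r _ => measurableSet_le (by fun_prop) (by fun_prop)

end ContinuousPaths

section HeatSemigroup

variable {Ω : Type*} [MeasurableSpace Ω] {P : Measure Ω} {W : ℝ≥0 → Ω → ℝ} {G : ℝ → ℝ} {C : ℝ}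

/-- The heat semigroup applied to `G`: the mean of `G` at a Gaussian variable of mean `x` and
variance `v`. -/
def heat (v : ℝ≥0) (G : ℝ → ℝ) (x : ℝ) : ℝ := ∫ z, G (x + z) ∂(gaussianReal 0 v)

lemma measurable_heat (v : ℝ≥0) (hG : Measurable G) : Measurable (heat v G) :=
  StronglyMeasurable.measurable <|
    (hG.comp (measurable_fst.add measurable_snd)).stronglyMeasurable.integral_prod_right'

lemma abs_heat_le (v : ℝ≥0) (hC : ∀ x, |G x| ≤ C) (x : ℝ) : |heat v G x| ≤ C := by
  simpa [heat] using norm_integral_le_of_norm_le_const (μ := gaussianReal 0 v)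
    (f := fun z => G (x + z)) (ae_of_all _ fun z => hC (x + z))

lemma abs_heat_sub_heat_le (v : ℝ≥0) (hG : Measurable G) (hC : ∀ x, |G x| ≤ C) {x y ε : ℝ}
    (hε : ∀ z, |G (x + z) - G (y + z)| ≤ ε) : |heat v G x - heat v G y| ≤ ε := by
  have hint : ∀ x, Integrable (fun z => G (x + z)) (gaussianReal 0 v) := fun x =>
    .of_bound (hG.comp (measurable_const_add x)).aestronglyMeasurable C (ae_of_all _ fun _ => hC _)
  rw [heat, heat, ← integral_sub (hint x) (hint y)]
  simpa using norm_integral_le_of_norm_le_const (μ := gaussianReal 0 v)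
    (f := fun z => G (x + z) - G (y + z)) (ae_of_all _ hε)

lemma hasLaw_sub_of_le (hW : IsPreBrownianReal W P) {t σ : ℝ≥0} (htσ : t ≤ σ) :
    HasLaw (fun ω => W σ ω - W t ω) (gaussianReal 0 (σ - t)) P := by
  have hdist : nndist (σ : ℝ) t = σ - t := by
    refine NNReal.eq ?_
    rw [coe_nndist, NNReal.coe_sub htσ, Real.dist_eq,
      abs_of_nonneg (sub_nonneg.2 (by exact_mod_cast htσ))]
  exact hdist ▸ hW.hasLaw_sub σ t

lemma setIntegral_eq_setIntegral_heat (hW : IsBrownianReal W P) {t σ : ℝ≥0} (htσ : t ≤ σ)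
    {K : Set (Set.Iic t → ℝ)} (hK : MeasurableSet K) (hG : Measurable G) (hC : ∀ x, |G x| ≤ C) :
    ∫ ω in {ω | (fun r : Set.Iic t => W r ω) ∈ K}, G (W σ ω) ∂P =
      ∫ ω in {ω | (fun r : Set.Iic t => W r ω) ∈ K}, heat (σ - t) G (W t ω) ∂P := by
  have := hW.isGaussianProcess.isProbabilityMeasure
  have hm := hW.aemeasurable
  let U : Ω → Set.Iic t → ℝ := fun ω r => W r ω
  let Z : Ω → ℝ := fun ω => W σ ω - W t ω
  let t' : Set.Iic t := ⟨t, Set.mem_Iic.2 le_rfl⟩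
  have hU : AEMeasurable U P :=
    aemeasurable_path (W := fun r : Set.Iic t => W r) (fun r => hm r)
      (hW.cont.mono fun ω hω => hω.comp continuous_subtype_val)
  have hZ : AEMeasurable Z P := (hm σ).sub (hm t)
  have hUZ : IndepFun U Z P := by
    have h := (hW.indepFun_shift t).symm.comp measurable_id
      (measurable_pi_apply (X := fun _ : ℝ≥0 => ℝ) (σ - t))
    simpa only [Function.comp_def, id, add_tsub_cancel_of_le htσ] using h
  have hZlaw : P.map Z = gaussianReal 0 (σ - t) :=
    (hasLaw_sub_of_le hW.toIsPreBrownianReal htσ).map_eq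
  have hf : Measurable fun x : (Set.Iic t → ℝ) × ℝ => G (x.1 t' + x.2) := by fun_prop
  calc ∫ ω in {ω | U ω ∈ K}, G (W σ ω) ∂P
    _ = ∫ ω in (fun ω => (U ω, Z ω)) ⁻¹' (K ×ˢ Set.univ), G (U ω t' + Z ω) ∂P := by
        simp only [U, Z, t', add_sub_cancel, Set.mk_preimage_prod, Set.preimage_univ,
          Set.inter_univ]
        rfl
    _ = ∫ x in K ×ˢ Set.univ, G (x.1 t' + x.2) ∂((P.map U).prod (gaussianReal 0 (σ - t))) := by
        rw [← hZlaw, ← (indepFun_iff_map_prod_eq_prod_map_map hU hZ).1 hUZ, setIntegral_map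
          (hK.prod .univ) hf.aestronglyMeasurable (hU.prodMk hZ)]
    _ = ∫ u in K, heat (σ - t) G (u t') ∂(P.map U) := by
        rw [setIntegral_prod _ (Integrable.of_bound hf.aestronglyMeasurable C
          (ae_of_all _ fun _ => hC _)).integrableOn]
        simp only [Measure.restrict_univ, heat]
    _ = ∫ ω in {ω | U ω ∈ K}, heat (σ - t) G (W t ω) ∂P :=
        setIntegral_map hK
          ((measurable_heat _ hG).comp (measurable_pi_apply t')).aestronglyMeasurable hU

lemma integral_sub_setIntegral_eq_sum {F : ℕ → Set Ω} (hF : Antitone F)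
    (hF0 : F 0 = Set.univ) (hFm : ∀ k, NullMeasurableSet (F k) P) {f : Ω → ℝ}
    (hf : Integrable f P) (K : ℕ) :
    ∫ ω, f ω ∂P - ∫ ω in F K, f ω ∂P =
      ∑ k ∈ Finset.range K, ∫ ω in F k \ F (k + 1), f ω ∂P := by
  have hdiff : ∀ k, ∫ ω in F k \ F (k + 1), f ω ∂P =
      ∫ ω in F k, f ω ∂P - ∫ ω in F (k + 1), f ω ∂P := fun k => by
    have h := integral_inter_add_sdiff₀ (hFm (k + 1)) (hf.integrableOn (s := F k))
    rw [Set.inter_eq_self_of_subset_right (hF k.le_succ)] at h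
    linarith
  simp_rw [hdiff, Finset.sum_range_sub', hF0, Measure.restrict_univ]

lemma sum_indicator_sdiff_eq {α : Type*} {F : ℕ → Set α} (hF : Antitone F) (f : ℕ → α → ℝ) (K : ℕ)
    (x : α) :
    (∃ k < K, x ∈ F k \ F (k + 1) ∧
      ∑ j ∈ Finset.range K, (F j \ F (j + 1)).indicator (f j) x = f k x) ∨
    ∑ j ∈ Finset.range K, (F j \ F (j + 1)).indicator (f j) x = 0 := by
  by_cases h : ∃ k < K, x ∈ F k \ F (k + 1)
  · obtain ⟨k, hk, hxk⟩ := h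
    refine Or.inl ⟨k, hk, hxk, ?_⟩
    rw [Finset.sum_eq_single_of_mem k (Finset.mem_range.2 hk), Set.indicator_of_mem hxk]
    refine fun j _ hjk => Set.indicator_of_notMem (fun hxj => ?_) _
    rcases hjk.lt_or_gt with hlt | hlt
    · exact hxj.2 (hF (Nat.succ_le_of_lt hlt) hxk.1)
    · exact hxk.2 (hF (Nat.succ_le_of_lt hlt) hxj.1)
  · push Not at h
    exact Or.inr <| Finset.sum_eq_zero fun j hj =>
      Set.indicator_of_notMem (h j (Finset.mem_range.1 hj)) _

end HeatSemigroup

section Grid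

lemma div_natCast_le_of_lt_floor_add_one {σ : ℝ≥0} {k n : ℕ} (hk : k < ⌊(σ : ℝ) * n⌋₊ + 1) :
    (k / n : ℝ≥0) ≤ σ := by
  have hkn : (k : ℝ) ≤ σ * n := (Nat.le_floor_iff (by positivity)).1 (Nat.lt_succ_iff.1 hk)
  exact div_le_of_le_mul₀ zero_le zero_le (by exact_mod_cast hkn)

variable {w : ℝ≥0 → ℝ} (hw : Continuous w) (σ : ℝ≥0)

include hw

lemma eventually_forall_abs_sub_lt {ε : ℝ} (hε : 0 < ε) :
    ∀ᶠ n : ℕ in atTop, ∀ k : ℕ, ((k + 1 : ℕ) / n : ℝ≥0) ≤ σ →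
      |w ((k + 1 : ℕ) / n) - w (k / n)| < ε := by
  obtain ⟨δ, hδ, h⟩ := Metric.uniformContinuousOn_iff.1
    (isCompact_Icc.uniformContinuousOn_of_continuous hw.continuousOn : UniformContinuousOn w
      (Set.Icc 0 σ)) ε hε
  filter_upwards [(tendsto_one_div_atTop_nhds_zero_nat (𝕜 := ℝ)).eventually_lt_const hδ]
    with n hn k hk
  have hle : (k / n : ℝ≥0) ≤ (k + 1 : ℕ) / n := by gcongr; exact k.le_succ
  refine h _ ⟨zero_le, hk⟩ _ ⟨zero_le, hle.trans hk⟩ ?_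
  rw [NNReal.dist_eq, abs_of_nonneg (sub_nonneg.2 (by exact_mod_cast hle))]
  push_cast
  rwa [← sub_div, add_sub_cancel_left]

lemma eventually_mem_belowLine_grid_iff (a c : ℝ) :
    ∀ᶠ n : ℕ in atTop,
      (w ∈ belowLine ((fun k : ℕ => (k / n : ℝ≥0)) '' Set.Iio (⌊(σ : ℝ) * n⌋₊ + 1)) a c ↔
        w ∈ belowLine (Set.Icc 0 σ) a c) := by
  by_cases h : w ∈ belowLine (Set.Icc 0 σ) a c
  · refine .of_forall fun n => iff_of_true (belowLine_anti ?_ a c h) h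
    rintro _ ⟨k, hk, rfl⟩
    exact ⟨zero_le, div_natCast_le_of_lt_floor_add_one hk⟩
  · obtain ⟨r, hr, hwr⟩ : ∃ r ≤ σ, a + c * r < w r := by simpa [belowLine] using h
    have hgrid : Tendsto (fun n : ℕ => (⌊(r : ℝ) * n⌋₊ / n : ℝ≥0)) atTop (𝓝 r) := by
      rw [← NNReal.tendsto_coe]
      simpa [Function.comp_def] using
        (tendsto_nat_floor_mul_div_atTop r.coe_nonneg).comp tendsto_natCast_atTop_atTop
    have hcross : ∀ᶠ n : ℕ in atTop,
        a + c * (⌊(r : ℝ) * n⌋₊ / n : ℝ≥0) < w (⌊(r : ℝ) * n⌋₊ / n) :=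
      hgrid.eventually ((isOpen_lt (f := fun r : ℝ≥0 => a + c * r) (by fun_prop) hw).mem_nhds hwr)
    filter_upwards [hcross] with n hn
    refine iff_of_false (fun hmem => (hmem _ ⟨_, ?_, rfl⟩).not_gt hn) h
    exact Nat.lt_succ_of_le (Nat.floor_le_floor (by gcongr))

end Grid

section FirstCrossing

variable {Ω : Type*} [MeasurableSpace Ω] {P : Measure Ω} {W : ℝ≥0 → Ω → ℝ} {G : ℝ → ℝ} {C : ℝ}

lemma nullMeasurableSet_belowLine (hW : ∀ r, AEMeasurable (W r) P)
    (hcont : ∀ᵐ ω ∂P, Continuous (W · ω)) (I : Set ℝ≥0) (a c : ℝ) :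
    NullMeasurableSet {ω | (W · ω) ∈ belowLine I a c} P :=
  (measurableOnContinuous_belowLine (α := Unit) I measurable_const
    measurable_const).nullMeasurableSet_preimage (X := fun _ => ()) aemeasurable_const hW hcont

/-- The paths which cross the line `r ↦ a + c * r` at time `t k` and not at `t 0, …, t (k - 1)`. -/
def firstCrossing (t : ℕ → ℝ≥0) (a c : ℝ) (k : ℕ) : Set (ℝ≥0 → ℝ) :=
  belowLine (t '' Set.Iio k) a c \ belowLine (t '' Set.Iio (k + 1)) a c

lemma mem_firstCrossing_iff {t : ℕ → ℝ≥0} {a c : ℝ} {k : ℕ} {w : ℝ≥0 → ℝ} :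
    w ∈ firstCrossing t a c k ↔ (∀ j < k, w (t j) ≤ a + c * t j) ∧ a + c * t k < w (t k) := by
  simp only [firstCrossing, belowLine, Set.mem_sdiff, Set.mem_ofPred_eq, Set.forall_mem_image,
    Set.mem_Iio, Nat.lt_succ_iff_lt_or_eq]
  grind

lemma setIntegral_firstCrossing (hW : IsBrownianReal W P) {t : ℕ → ℝ≥0} (ht : Monotone t)
    (a c : ℝ) {σ : ℝ≥0} {k : ℕ} (hk : t k ≤ σ) (hG : Measurable G) (hC : ∀ x, |G x| ≤ C) :
    ∫ ω in {ω | (W · ω) ∈ firstCrossing t a c k}, G (W σ ω) ∂P =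
      ∫ ω in {ω | (W · ω) ∈ firstCrossing t a c k}, heat (σ - t k) G (W (t k) ω) ∂P := by
  let K : Set (Set.Iic (t k) → ℝ) :=
    (⋂ (j) (hj : j < k), {u | u ⟨t j, ht hj.le⟩ ≤ a + c * t j}) ∩
      {u | a + c * t k < u ⟨t k, Set.mem_Iic.2 le_rfl⟩}
  have hK : MeasurableSet K :=
    (MeasurableSet.iInter fun j => .iInter fun hj =>
      measurableSet_le (measurable_pi_apply _) measurable_const).inter
        (measurableSet_lt measurable_const (measurable_pi_apply _))
  have hevent : {ω | (W · ω) ∈ firstCrossing t a c k} =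
      {ω | (fun r : Set.Iic (t k) => W r ω) ∈ K} := by
    ext ω
    simp only [Set.mem_ofPred_eq, mem_firstCrossing_iff, K, Set.mem_inter_iff, Set.mem_iInter]
  rw [hevent]
  exact setIntegral_eq_setIntegral_heat hW hk hK hG hC

/-- The heat evolution of `G`, with horizon `σ`, at the first of the times `t 0, …, t (K - 1)` at
which the path `w` has crossed the line `r ↦ a + c * r`, and `0` if there is none. -/
def crossingValue (t : ℕ → ℝ≥0) (a c : ℝ) (σ : ℝ≥0) (G : ℝ → ℝ) (K : ℕ) (w : ℝ≥0 → ℝ) : ℝ :=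
  ∑ k ∈ Finset.range K, (firstCrossing t a c k).indicator (fun w => heat (σ - t k) G (w (t k))) w

lemma crossingValue_eq (t : ℕ → ℝ≥0) (a c : ℝ) (σ : ℝ≥0) (G : ℝ → ℝ) (K : ℕ) (w : ℝ≥0 → ℝ) :
    (∃ k < K, w ∈ firstCrossing t a c k ∧
      crossingValue t a c σ G K w = heat (σ - t k) G (w (t k))) ∨
    crossingValue t a c σ G K w = 0 :=
  sum_indicator_sdiff_eq (F := fun k => belowLine (t '' Set.Iio k) a c)
    (fun _ _ h => belowLine_anti (Set.image_mono (Set.Iio_subset_Iio h)) a c) _ K w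

lemma abs_crossingValue_le (t : ℕ → ℝ≥0) (a c : ℝ) (σ : ℝ≥0) (hC : ∀ x, |G x| ≤ C) (K : ℕ)
    (w : ℝ≥0 → ℝ) : |crossingValue t a c σ G K w| ≤ C := by
  rcases crossingValue_eq t a c σ G K w with ⟨k, -, -, h⟩ | h <;> rw [h]
  · exact abs_heat_le _ hC _
  · exact abs_zero.trans_le ((abs_nonneg _).trans (hC 0))

lemma aestronglyMeasurable_crossingValue (hW : ∀ r, AEMeasurable (W r) P)
    (hcont : ∀ᵐ ω ∂P, Continuous (W · ω)) (t : ℕ → ℝ≥0) (a c : ℝ) (σ : ℝ≥0) (hG : Measurable G)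
    (K : ℕ) : AEStronglyMeasurable (fun ω => crossingValue t a c σ G K (W · ω)) P := by
  refine Finset.aestronglyMeasurable_fun_sum _ fun k _ => ?_
  exact ((measurable_heat _ hG).comp_aemeasurable (hW (t k))).aestronglyMeasurable.indicator₀
    ((nullMeasurableSet_belowLine hW hcont _ a c).diff (nullMeasurableSet_belowLine hW hcont _ a c))

lemma integral_sub_setIntegral_eq_integral_crossingValue (hW : IsBrownianReal W P) {t : ℕ → ℝ≥0}
    (ht : Monotone t) (a c : ℝ) {σ : ℝ≥0} {K : ℕ} (hK : ∀ k < K, t k ≤ σ) (hG : Measurable G)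
    (hC : ∀ x, |G x| ≤ C) :
    ∫ ω, G (W σ ω) ∂P - ∫ ω in {ω | (W · ω) ∈ belowLine (t '' Set.Iio K) a c}, G (W σ ω) ∂P =
      ∫ ω, crossingValue t a c σ G K (W · ω) ∂P := by
  have := hW.isGaussianProcess.isProbabilityMeasure
  have hm := hW.aemeasurable
  have hbelow := fun k => nullMeasurableSet_belowLine hm hW.cont (t '' Set.Iio k) a c
  have hfirst : ∀ k, NullMeasurableSet {ω | (W · ω) ∈ firstCrossing t a c k} P := fun k =>
    (hbelow k).diff (hbelow (k + 1))
  have hint : ∀ r {g : ℝ → ℝ}, Measurable g → (∀ x, |g x| ≤ C) →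
      Integrable (fun ω => g (W r ω)) P := fun r g hg hgC =>
    .of_bound (hg.comp_aemeasurable (hm r)).aestronglyMeasurable C
      (ae_of_all _ fun _ => hgC _)
  rw [integral_sub_setIntegral_eq_sum (F := fun k => {ω | (W · ω) ∈ belowLine (t '' Set.Iio k) a c})
    (fun _ _ h ω hω => belowLine_anti (Set.image_mono (Set.Iio_subset_Iio h)) a c hω)
    (by simp [belowLine]) hbelow (hint σ hG hC)]
  simp only [crossingValue]
  rw [integral_finsetSum]
  · refine Finset.sum_congr rfl fun k hk => ?_
    refine (setIntegral_firstCrossing hW ht a c (hK k (Finset.mem_range.1 hk)) hG hC).trans ?_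
    exact (integral_indicator₀ (hfirst k)).symm
  · exact fun k _ =>
      (hint (t k) (measurable_heat _ hG) (abs_heat_le _ hC)).indicator₀ (hfirst k)

lemma tendsto_crossingValue_grid {a c : ℝ} {σ : ℝ≥0} (hG : UniformContinuous G)
    (hC : ∀ x, |G x| ≤ C) (hzero : ∀ v ≤ σ, heat v G (a + c * (σ - v)) = 0) {w : ℝ≥0 → ℝ}
    (hw : Continuous w) (hw0 : w 0 < a) :
    Tendsto (fun n : ℕ => crossingValue (fun k => k / n) a c σ G (⌊(σ : ℝ) * n⌋₊ + 1) w) atTop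
      (𝓝 0) := by
  rw [Metric.tendsto_nhds]
  intro ε hε
  obtain ⟨δ, hδ, hGδ⟩ := Metric.uniformContinuous_iff.1 hG (ε / 2) (half_pos hε)
  have hdrift : Continuous fun r : ℝ≥0 => w r - c * r := by fun_prop
  filter_upwards [eventually_forall_abs_sub_lt hdrift σ hδ] with n hosc
  rw [dist_zero_right, Real.norm_eq_abs]
  obtain ⟨k, hk, hcross, h⟩ | h := crossingValue_eq (fun k => k / n) a c σ G (⌊(σ : ℝ) * n⌋₊ + 1) w
  swap
  · rwa [h, abs_zero]
  obtain ⟨hbefore, hafter⟩ := mem_firstCrossing_iff.1 hcross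
  have hkσ : (k / n : ℝ≥0) ≤ σ := div_natCast_le_of_lt_floor_add_one hk
  obtain _ | j := k
  · simp at hafter
    linarith
  set r : ℝ≥0 := (j + 1 : ℕ) / n
  have hclose : |w r - (a + c * r)| < δ := by
    have hprev := hbefore j j.lt_succ_self
    have := (abs_lt.1 (hosc j hkσ)).2
    rw [abs_of_pos (sub_pos.2 hafter)]
    linarith
  have hline : heat (σ - r) G (a + c * r) = 0 := by
    have h0 := hzero (σ - r) tsub_le_self
    rwa [NNReal.coe_sub hkσ, sub_sub_cancel] at h0
  calc |crossingValue (fun k => k / n) a c σ G (⌊(σ : ℝ) * n⌋₊ + 1) w|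
    _ = |heat (σ - r) G (w r) - heat (σ - r) G (a + c * r)| := by rw [h, hline, sub_zero]
    _ ≤ ε / 2 := abs_heat_sub_heat_le _ hG.continuous.measurable hC fun z => by
        rw [← Real.dist_eq]
        exact (hGδ (by rwa [dist_add_right, Real.dist_eq])).le
    _ < ε := half_lt_self hε

lemma tendsto_setIntegral_of_eventually_mem_iff {f : Ω → ℝ} (hf : Integrable f P)
    {A : ℕ → Set Ω} {A' : Set Ω} (hA : ∀ n, NullMeasurableSet (A n) P)
    (hA' : NullMeasurableSet A' P) (h : ∀ᵐ ω ∂P, ∀ᶠ n in atTop, (ω ∈ A n ↔ ω ∈ A')) :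
    Tendsto (fun n => ∫ ω in A n, f ω ∂P) atTop (𝓝 (∫ ω in A', f ω ∂P)) := by
  simp_rw [← integral_indicator₀ hA', ← integral_indicator₀ (hA _)]
  refine tendsto_integral_of_dominated_convergence (fun ω => ‖f ω‖)
    (fun n => hf.1.indicator₀ (hA n)) hf.norm
    (fun n => ae_of_all _ fun ω => norm_indicator_le_norm_self f ω) ?_
  filter_upwards [h] with ω hω
  refine tendsto_const_nhds.congr' ?_
  filter_upwards [hω] with n hn
  exact Set.indicator_eq_indicator hn.symm rfl

/-- At the first crossing, the conditional mean of `G (W σ)` is the heat evolution of `G`, which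
vanishes on the line. -/
theorem setIntegral_belowLine_eq_integral (hW : IsBrownianReal W P) {a c : ℝ} (ha : 0 < a)
    (σ : ℝ≥0) (hG : UniformContinuous G) (hC : ∀ x, |G x| ≤ C)
    (hzero : ∀ v ≤ σ, heat v G (a + c * (σ - v)) = 0) :
    ∫ ω in {ω | (W · ω) ∈ belowLine (Set.Icc 0 σ) a c}, G (W σ ω) ∂P = ∫ ω, G (W σ ω) ∂P := by
  have := hW.isGaussianProcess.isProbabilityMeasure
  have hm := hW.aemeasurable
  have hGm : Measurable G := hG.continuous.measurable
  let t : ℕ → ℕ → ℝ≥0 := fun n k => k / n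
  let K : ℕ → ℕ := fun n => ⌊(σ : ℝ) * n⌋₊ + 1
  have hbelow : Tendsto
      (fun n => ∫ ω in {ω | (W · ω) ∈ belowLine (t n '' Set.Iio (K n)) a c}, G (W σ ω) ∂P) atTop
      (𝓝 (∫ ω in {ω | (W · ω) ∈ belowLine (Set.Icc 0 σ) a c}, G (W σ ω) ∂P)) := by
    refine tendsto_setIntegral_of_eventually_mem_iff
      (.of_bound (hGm.comp_aemeasurable (hm σ)).aestronglyMeasurable C (ae_of_all _ fun _ => hC _))
      (fun n => nullMeasurableSet_belowLine hm hW.cont _ a c)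
      (nullMeasurableSet_belowLine hm hW.cont _ a c) ?_
    filter_upwards [hW.cont] with ω hω
    exact eventually_mem_belowLine_grid_iff hω σ a c
  have hcrossing : Tendsto (fun n => ∫ ω, crossingValue (t n) a c σ G (K n) (W · ω) ∂P) atTop
      (𝓝 (∫ _, 0 ∂P)) := by
    refine tendsto_integral_of_dominated_convergence (fun _ => C)
      (fun n => aestronglyMeasurable_crossingValue hm hW.cont _ a c σ hGm _) (integrable_const _)
      (fun n => ae_of_all _ fun ω => abs_crossingValue_le _ a c σ hC _ _) ?_
    filter_upwards [hW.cont, hW.eval_zero_ae_eq_zero] with ω hω h0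
    exact tendsto_crossingValue_grid hG hC hzero hω (h0.trans_lt ha)
  have hsplit : ∀ n, ∫ ω, G (W σ ω) ∂P -
      ∫ ω in {ω | (W · ω) ∈ belowLine (t n '' Set.Iio (K n)) a c}, G (W σ ω) ∂P =
      ∫ ω, crossingValue (t n) a c σ G (K n) (W · ω) ∂P := fun n =>
    integral_sub_setIntegral_eq_integral_crossingValue hW
      (fun j k hjk => by simp only [t]; gcongr) a c
      (fun k hk => div_natCast_le_of_lt_floor_add_one hk) hGm hC
  rw [integral_zero] at hcrossing
  simp_rw [← hsplit] at hcrossing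
  linarith [tendsto_nhds_unique hcrossing (hbelow.const_sub _)]

end FirstCrossing

section Reflection

variable {g : ℝ → ℝ} {a c b : ℝ} {σ : ℝ≥0}

/-- The reflection of `g` at `b`, antisymmetrised with the weight that a Brownian motion with
drift `-c` requires. -/
def reflect (c b : ℝ) (g : ℝ → ℝ) (y : ℝ) : ℝ := g y - Real.exp (2 * c * (y - b)) * g (2 * b - y)

lemma continuous_reflect (hg : Continuous g) : Continuous (reflect c b g) := by
  unfold reflect
  fun_prop

lemma hasCompactSupport_reflect (hg : HasCompactSupport g) :
    HasCompactSupport (reflect c b g) :=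
  hg.sub <| (hg.comp_homeomorph (Homeomorph.subLeft (2 * b))).mul_left
    (f := fun y => Real.exp (2 * c * (y - b)))

/-- The density of the law of `W σ` on the event that the Brownian motion `W` stays below the
line `r ↦ a + c * r` on `[0, σ]`. -/
def stayBelowDensity (a c : ℝ) (σ : ℝ≥0) (y : ℝ) : ℝ :=
  gaussianPDFReal 0 σ y - Real.exp (-(2 * c * a)) * gaussianPDFReal (2 * a) σ y

lemma continuous_gaussianPDFReal (μ : ℝ) (v : ℝ≥0) : Continuous (gaussianPDFReal μ v) := by
  unfold gaussianPDFReal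
  fun_prop

lemma continuous_stayBelowDensity (a c : ℝ) (σ : ℝ≥0) : Continuous (stayBelowDensity a c σ) :=
  (continuous_gaussianPDFReal 0 σ).sub ((continuous_gaussianPDFReal (2 * a) σ).const_mul _)

lemma stayBelowDensity_eq (hσ : σ ≠ 0) (y : ℝ) :
    stayBelowDensity a c σ y =
      gaussianPDFReal 0 σ y * (1 - Real.exp (-(2 * a * (a + c * σ - y) / σ))) := by
  have hσ' : (σ : ℝ) ≠ 0 := NNReal.coe_ne_zero.2 hσ
  simp only [stayBelowDensity, gaussianPDFReal, mul_sub, mul_one]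
  rw [mul_left_comm, mul_assoc (√_)⁻¹, ← Real.exp_add, ← Real.exp_add]
  congr 3
  field_simp
  ring

lemma stayBelowDensity_nonneg (ha : 0 ≤ a) (hσ : σ ≠ 0) {y : ℝ} (hy : y ≤ a + c * σ) :
    0 ≤ stayBelowDensity a c σ y := by
  rw [stayBelowDensity_eq hσ]
  have hline : 0 ≤ a + c * σ - y := sub_nonneg.2 hy
  have hexp : Real.exp (-(2 * a * (a + c * σ - y) / σ)) ≤ 1 :=
    Real.exp_le_one_iff.2
      (neg_nonpos.2 (div_nonneg (mul_nonneg (by positivity) hline) σ.coe_nonneg))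
  exact mul_nonneg (gaussianPDFReal_nonneg _ _ _) (sub_nonneg.2 hexp)

lemma gaussianPDFReal_reflect_mul_exp (hσ : σ ≠ 0) (a c y : ℝ) :
    gaussianPDFReal 0 σ (2 * (a + c * σ) - y) * Real.exp (2 * c * (a + c * σ - y)) =
      Real.exp (-(2 * c * a)) * gaussianPDFReal (2 * a) σ y := by
  have hσ' : (σ : ℝ) ≠ 0 := NNReal.coe_ne_zero.2 hσ
  simp only [gaussianPDFReal]
  rw [mul_assoc, mul_left_comm (Real.exp (-(2 * c * a))), ← Real.exp_add, ← Real.exp_add]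
  congr 2
  field_simp
  ring

lemma integral_reflect_gaussianReal (hσ : σ ≠ 0) (hg : Continuous g) (hgc : HasCompactSupport g) :
    ∫ y, reflect c (a + c * σ) g y ∂(gaussianReal 0 σ) = ∫ y, g y * stayBelowDensity a c σ y := by
  set b := a + c * σ with hb
  have hpdf := continuous_gaussianPDFReal 0 σ
  have hint : Integrable fun y => g y * gaussianPDFReal 0 σ y :=
    (hg.mul hpdf).integrable_of_hasCompactSupport hgc.mul_right
  have hint' : Integrable fun y => g (2 * b - y) *
      (gaussianPDFReal 0 σ y * Real.exp (2 * c * (y - b))) :=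
    Continuous.integrable_of_hasCompactSupport (by fun_prop)
      (hgc.comp_homeomorph (Homeomorph.subLeft (2 * b))).mul_right
  have hint'' : Integrable fun y => g y * (Real.exp (-(2 * c * a)) * gaussianPDFReal (2 * a) σ y) :=
    (hg.mul (continuous_const.mul (continuous_gaussianPDFReal _ _))).integrable_of_hasCompactSupport
      hgc.mul_right
  have hsubst : ∫ y, g (2 * b - y) * (gaussianPDFReal 0 σ y * Real.exp (2 * c * (y - b))) =
      ∫ y, g y * (Real.exp (-(2 * c * a)) * gaussianPDFReal (2 * a) σ y) := by
    rw [← integral_sub_left_eq_self _ volume (2 * b)]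
    refine integral_congr_ae (ae_of_all _ fun y => ?_)
    beta_reduce
    rw [sub_sub_cancel, ← gaussianPDFReal_reflect_mul_exp hσ, ← hb,
      show 2 * b - y - b = b - y by ring]
  calc ∫ y, reflect c b g y ∂(gaussianReal 0 σ)
      = ∫ y, g y * gaussianPDFReal 0 σ y -
          g (2 * b - y) * (gaussianPDFReal 0 σ y * Real.exp (2 * c * (y - b))) := by
        rw [integral_gaussianReal_eq_integral_smul hσ]
        simp only [reflect, smul_eq_mul]
        congr with y
        ring
    _ = ∫ y, g y * stayBelowDensity a c σ y := by
        rw [integral_sub hint hint', hsubst, ← integral_sub hint hint'']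
        simp only [stayBelowDensity, mul_sub]

lemma heat_reflect_eq_zero (hg : Continuous g) (hgc : HasCompactSupport g) (c b : ℝ) (v : ℝ≥0) :
    heat v (reflect c b g) (b - c * v) = 0 := by
  rcases eq_or_ne v 0 with rfl | hv
  · simp [heat, reflect, two_mul]
  have htrans : ∀ z, reflect c b g (b - c * v + z) =
      reflect c (0 + c * v) (fun z => g (b - c * v + z)) z := fun z => by
    simp only [reflect]
    ring_nf
  simp_rw [heat, htrans]
  rw [integral_reflect_gaussianReal (g := fun z => g (b - c * v + z)) hv (by fun_prop)
    (hgc.comp_homeomorph (Homeomorph.addLeft (b - c * v)))]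
  simp [stayBelowDensity]

end Reflection

section Law

variable {Ω : Type*} [MeasurableSpace Ω] {P : Measure Ω} {W : ℝ≥0 → Ω → ℝ}

open scoped CompactlySupported in
lemma ext_of_integral_mul_eq_of_ae_pos {μ ν : Measure ℝ} [IsLocallyFiniteMeasure μ]
    [IsLocallyFiniteMeasure ν] {χ : ℝ → ℝ≥0} (hχ : Continuous χ) (hμ : ∀ᵐ y ∂μ, 0 < χ y)
    (hν : ∀ᵐ y ∂ν, 0 < χ y) (h : ∀ f : C_c(ℝ, ℝ), ∫ y, f y * χ y ∂μ = ∫ y, f y * χ y ∂ν) :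
    μ = ν := by
  have := IsLocallyFiniteMeasure.withDensity_coe (μ := μ) hχ
  have := IsLocallyFiniteMeasure.withDensity_coe (μ := ν) hχ
  have hχμν : μ.withDensity (fun y => χ y) = ν.withDensity (fun y => χ y) := by
    refine Measure.ext_of_integral_eq_on_compactlySupported fun f => ?_
    simpa only [integral_withDensity_eq_integral_smul hχ.measurable, NNReal.smul_def, smul_eq_mul,
      mul_comm] using h f
  have hcancel : ∀ κ : Measure ℝ, (∀ᵐ y ∂κ, 0 < χ y) →
      (κ.withDensity fun y => χ y).withDensity (fun y => (χ y : ENNReal)⁻¹) = κ := fun κ hκ =>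
    withDensity_inv_same (by fun_prop) (hκ.mono fun y hy => by simpa using hy.ne')
      (ae_of_all _ fun y => ENNReal.coe_ne_top)
  rw [← hcancel μ hμ, ← hcancel ν hν, hχμν]

lemma setIntegral_belowLine_eq_integral_stayBelowDensity (hW : IsBrownianReal W P) {a c : ℝ}
    (ha : 0 < a) {σ : ℝ≥0} (hσ : σ ≠ 0) {g : ℝ → ℝ} (hg : Continuous g)
    (hgc : HasCompactSupport g) (hg0 : ∀ y, a + c * σ ≤ y → g y = 0) :
    ∫ ω in {ω | (W · ω) ∈ belowLine (Set.Icc 0 σ) a c}, g (W σ ω) ∂P =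
      ∫ y, g y * stayBelowDensity a c σ y := by
  set b := a + c * σ with hb
  have hr := continuous_reflect (c := c) (b := b) hg
  have hrc := hasCompactSupport_reflect (c := c) (b := b) hgc
  have hlaw := hW.hasLaw_eval σ
  obtain ⟨C, hC⟩ := hrc.exists_bound_of_continuous hr
  have hreflect : ∫ ω in {ω | (W · ω) ∈ belowLine (Set.Icc 0 σ) a c}, g (W σ ω) ∂P =
      ∫ ω in {ω | (W · ω) ∈ belowLine (Set.Icc 0 σ) a c}, reflect c b g (W σ ω) ∂P := by
    refine setIntegral_congr_fun₀
      (nullMeasurableSet_belowLine hW.aemeasurable hW.cont (Set.Icc 0 σ) a c) fun ω hω => ?_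
    have hWσ : W σ ω ≤ b := hω σ (by simp)
    simp [reflect, hg0 (2 * b - W σ ω) (by linarith)]
  rw [hreflect, setIntegral_belowLine_eq_integral hW ha σ
      (hrc.uniformContinuous_of_continuous hr) hC
      fun v _ => by
        rw [show a + c * (σ - v) = b - c * v by rw [hb]; ring, heat_reflect_eq_zero hg hgc],
    ← integral_map hlaw.aemeasurable hr.aestronglyMeasurable, hlaw.map_eq,
    integral_reflect_gaussianReal hσ hg hgc]

theorem map_restrict_belowLine (hW : IsBrownianReal W P) {a c : ℝ} (ha : 0 < a) {σ : ℝ≥0}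
    (hσ : σ ≠ 0) :
    (P.restrict {ω | (W · ω) ∈ belowLine (Set.Icc 0 σ) a c}).map (W σ) =
      (volume.restrict (Set.Iio (a + c * σ))).withDensity
        fun y => ENNReal.ofReal (stayBelowDensity a c σ y) := by
  have := hW.isGaussianProcess.isProbabilityMeasure
  set b := a + c * σ
  set E := {ω | (W · ω) ∈ belowLine (Set.Icc 0 σ) a c}
  have hE : NullMeasurableSet E P := nullMeasurableSet_belowLine hW.aemeasurable hW.cont _ a c
  have hWσ : AEMeasurable (W σ) (P.restrict E) := (hW.aemeasurable σ).restrict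
  have hdens := continuous_stayBelowDensity a c σ
  have := IsLocallyFiniteMeasure.withDensity_ofReal (μ := volume.restrict (Set.Iio b)) hdens
  have hχ : Continuous fun y : ℝ => (b - y).toNNReal := by fun_prop
  have hWσ_ne : ∀ᵐ ω ∂P, W σ ω ≠ b := by
    have := nullSingletonClass_gaussianReal (μ := 0) hσ
    refine ae_of_ae_map (p := (· ≠ b)) (hW.aemeasurable σ) ?_
    rw [(hW.hasLaw_eval σ).map_eq]
    exact Measure.ae_ne _ b
  refine ext_of_integral_mul_eq_of_ae_pos hχ ?_ ?_ fun f => ?_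
  · rw [ae_map_iff hWσ (measurableSet_lt measurable_const hχ.measurable), ae_restrict_iff'₀ hE]
    filter_upwards [hWσ_ne] with ω hne hω
    simpa using (hω σ (by simp)).lt_of_ne hne
  · refine (withDensity_absolutelyContinuous _ _).ae_le
      ((ae_restrict_iff' measurableSet_Iio).2 (ae_of_all _ fun y hy => ?_))
    simpa using hy
  rw [integral_map hWσ (by fun_prop),
    setIntegral_belowLine_eq_integral_stayBelowDensity hW ha hσ
      (g := fun y => f y * (b - y).toNNReal) (by fun_prop) f.hasCompactSupport.mul_right
      fun y hy => by rw [Real.toNNReal_of_nonpos (sub_nonpos.2 hy)]; simp,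
    integral_withDensity_eq_integral_toReal_smul (by fun_prop) (by simp),
    ← setIntegral_eq_integral_of_forall_compl_eq_zero (s := Set.Iio b)
      fun y hy => by simp [Real.toNNReal_of_nonpos (sub_nonpos.2 (not_lt.1 hy))]]
  refine setIntegral_congr_fun measurableSet_Iio fun y hy => ?_
  simp only [smul_eq_mul, ENNReal.toReal_ofReal (stayBelowDensity_nonneg ha.le hσ hy.le), mul_comm]

lemma setIntegral_Iio_gaussianPDFReal (μ b : ℝ) {v : ℝ≥0} (hv : v ≠ 0) :
    ∫ y in Set.Iio b, gaussianPDFReal μ v y = Phi ((b - μ) / √v) := by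
  have hs : 0 < √(v : ℝ) := Real.sqrt_pos.2 (by positivity)
  have := nullSingletonClass_gaussianReal (μ := μ) hv
  have hmap : gaussianReal μ v = (gaussianReal 0 1).map fun x => √v * x + μ := by
    have hscale : (gaussianReal 0 1).map (√v * ·) = gaussianReal 0 v := by
      rw [gaussianReal_map_const_mul]
      congr 1
      · simp
      · ext
        simp
    rw [← zero_add μ, ← gaussianReal_map_add_const, ← hscale,
      Measure.map_map (by fun_prop) (by fun_prop), zero_add]
    rfl
  have hreal : (gaussianReal μ v).real (Set.Iio b) = ∫ y in Set.Iio b, gaussianPDFReal μ v y := by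
    rw [measureReal_def, gaussianReal_apply_eq_integral μ hv, ENNReal.toReal_ofReal]
    exact integral_nonneg fun y => gaussianPDFReal_nonneg _ _ _
  rw [← hreal, measureReal_congr Iio_ae_eq_Iic, Phi, cdf_eq_real, hmap,
    map_measureReal_apply (by fun_prop) measurableSet_Iic]
  congr with x
  simp [le_div_iff₀ hs, le_sub_iff_add_le, mul_comm]

lemma setIntegral_stayBelowDensity (a c : ℝ) {σ : ℝ≥0} (hσ : σ ≠ 0) :
    ∫ y in Set.Iio (a + c * σ), stayBelowDensity a c σ y = bachelierLevy a c √σ := by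
  have hs : √(σ : ℝ) ≠ 0 := (Real.sqrt_pos.2 (by positivity)).ne'
  have hss : √(σ : ℝ) ^ 2 = σ := Real.sq_sqrt σ.coe_nonneg
  simp only [stayBelowDensity]
  rw [integral_sub (integrable_gaussianPDFReal _ _).restrict
    ((integrable_gaussianPDFReal _ _).const_mul _).restrict, integral_const_mul,
    setIntegral_Iio_gaussianPDFReal _ _ hσ, setIntegral_Iio_gaussianPDFReal _ _ hσ,
    bachelierLevy, if_neg hs]
  congr 3
  · field_simp
    rw [hss]
    ring
  · field_simp
    rw [hss]
    ring

lemma bachelierLevy_nonneg {a : ℝ} (ha : 0 ≤ a) (c : ℝ) (σ : ℝ≥0) :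
    0 ≤ bachelierLevy a c √σ := by
  rcases eq_or_ne σ 0 with rfl | hσ
  · simp [bachelierLevy]
  · rw [← setIntegral_stayBelowDensity a c hσ]
    exact setIntegral_nonneg measurableSet_Iio
      fun y hy => stayBelowDensity_nonneg ha hσ (le_of_lt hy)

theorem measureReal_belowLine (hW : IsBrownianReal W P) {a : ℝ} (ha : 0 < a) (c : ℝ) (σ : ℝ≥0) :
    P.real {ω | (W · ω) ∈ belowLine (Set.Icc 0 σ) a c} = bachelierLevy a c √σ := by
  have := hW.isGaussianProcess.isProbabilityMeasure
  rcases eq_or_ne σ 0 with rfl | hσ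
  · have hbelow : {ω | (W · ω) ∈ belowLine (Set.Icc 0 0) a c} =ᵐ[P] Set.univ := by
      refine eventuallyEq_univ.2 ?_
      filter_upwards [hW.eval_zero_ae_eq_zero] with ω hω
      simp [belowLine, hω, ha.le]
    rw [measureReal_congr hbelow]
    simp [bachelierLevy]
  have hdens : 0 ≤ᵐ[volume.restrict (Set.Iio (a + c * σ))] stayBelowDensity a c σ :=
    (ae_restrict_iff' measurableSet_Iio).2
      (ae_of_all _ fun y hy => stayBelowDensity_nonneg ha.le hσ (le_of_lt hy))
  rw [← measureReal_restrict_apply_univ,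
    ← Set.preimage_univ (f := W σ),
    ← map_measureReal_apply_of_aemeasurable (hW.aemeasurable σ).restrict .univ,
    map_restrict_belowLine hW ha hσ, measureReal_def, withDensity_apply _ .univ,
    Measure.restrict_univ, ← integral_eq_lintegral_of_nonneg_ae hdens
      (continuous_stayBelowDensity a c σ).aestronglyMeasurable,
    setIntegral_stayBelowDensity a c hσ]

end Law

section TwoStage

variable {Ω : Type*} [MeasurableSpace Ω] {P : Measure Ω} {W : ℝ≥0 → Ω → ℝ}

lemma mem_belowLine_Icc_iff_shift {σ τ : ℝ≥0} (hστ : σ ≤ τ) {A C : ℝ} {w : ℝ≥0 → ℝ} :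
    w ∈ belowLine (Set.Icc σ τ) A C ↔
      (fun r => w (σ + r) - w σ) ∈ belowLine (Set.Icc 0 (τ - σ)) (A + C * σ - w σ) C := by
  constructor
  · intro hw r hr
    have hline := hw (σ + r) ⟨le_self_add, (le_tsub_iff_left hστ).1 hr.2⟩
    push_cast at hline
    linarith
  · intro hw r hr
    have hline := hw (r - σ) ⟨zero_le, tsub_le_tsub_right hr.2 σ⟩
    simp only [add_tsub_cancel_of_le hr.1, NNReal.coe_sub hr.1] at hline
    linarith

lemma exists_measurableSet_restrict_mem_iff (σ : ℝ≥0) (a c : ℝ) :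
    ∃ K : Set (Set.Iic σ → ℝ), MeasurableSet K ∧
      ∀ w : ℝ≥0 → ℝ, Continuous w →
        ((fun r : Set.Iic σ => w r) ∈ K ↔ w ∈ belowLine (Set.Icc 0 σ) a c) := by
  obtain ⟨D, hDI, hDc, hD⟩ :=
    (TopologicalSpace.IsSeparable.of_separableSpace (Set.Icc 0 σ)).exists_countable_dense_subset
  refine ⟨{u | ∀ r : Set.Iic σ, (r : ℝ≥0) ∈ D → u r ≤ a + c * (r : ℝ≥0)}, ?_, fun w hw =>
    ⟨fun h => mem_belowLine_of_subset_closure hD hw fun r hr => h ⟨r, (hDI hr).2⟩ hr,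
      fun h r _ => h r ⟨zero_le, r.2⟩⟩⟩
  simp only [Set.ofPred_forall]
  exact .biInter (hDc.preimage Subtype.val_injective)
    fun r _ => measurableSet_le (measurable_pi_apply r) measurable_const

lemma measure_belowLine_inter_belowLine (hW : IsBrownianReal W P) {σ τ : ℝ≥0} (hστ : σ ≤ τ)
    (a c A C : ℝ) :
    P {ω | (W · ω) ∈ belowLine (Set.Icc 0 σ) a c ∩ belowLine (Set.Icc σ τ) A C} =
      ∫⁻ ω in {ω | (W · ω) ∈ belowLine (Set.Icc 0 σ) a c},
        P {ω' | (fun r => W (σ + r) ω' - W σ ω') ∈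
          belowLine (Set.Icc 0 (τ - σ)) (A + C * σ - W σ ω) C} ∂P := by
  have := hW.isGaussianProcess.isProbabilityMeasure
  have hZ := hW.shift σ
  obtain ⟨K, hK, hWK⟩ := exists_measurableSet_restrict_mem_iff σ a c
  let X : Ω → Set.Iic σ → ℝ := fun ω r => W r ω
  have hX : AEMeasurable X P :=
    aemeasurable_path (W := fun r : Set.Iic σ => W r) (fun r => hW.aemeasurable r)
      (hW.cont.mono fun ω hω => hω.comp continuous_subtype_val)
  let last : Set.Iic σ := ⟨σ, Set.self_mem_Iic⟩
  let S : Set ((Set.Iic σ → ℝ) × (ℝ≥0 → ℝ)) :=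
    {z | z.1 ∈ K} ∩ {z | z.2 ∈ belowLine (Set.Icc 0 (τ - σ)) (A + C * σ - z.1 last) C}
  have hS : MeasurableOnContinuous S :=
    (MeasurableOnContinuous.of_measurableSet (measurable_fst hK)).inter
      (measurableOnContinuous_belowLine _ (a := fun u : Set.Iic σ → ℝ => A + C * σ - u last)
        (by fun_prop) measurable_const)
  calc P {ω | (W · ω) ∈ belowLine (Set.Icc 0 σ) a c ∩ belowLine (Set.Icc σ τ) A C}
    _ = P {ω | (X ω, fun r => W (σ + r) ω - W σ ω) ∈ S} := by
        refine measure_congr ?_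
        filter_upwards [hW.cont] with ω hω
        exact propext (and_congr (hWK _ hω).symm (mem_belowLine_Icc_iff_shift hστ))
    _ = ∫⁻ ω, P {ω' | (X ω, fun r => W (σ + r) ω' - W σ ω') ∈ S} ∂P :=
        hS.measure_preimage_of_indepFun (hW.indepFun_shift σ).symm hX hZ.aemeasurable hZ.cont
    _ = _ := by
        rw [← lintegral_indicator₀ (nullMeasurableSet_belowLine hW.aemeasurable hW.cont _ a c)]
        refine lintegral_congr_ae ?_
        filter_upwards [hW.cont] with ω hω
        have hmem : ω ∈ {ω | (W · ω) ∈ belowLine (Set.Icc 0 σ) a c} ↔ X ω ∈ K := (hWK _ hω).symm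
        by_cases h : X ω ∈ K
        · rw [Set.indicator_of_mem (hmem.2 h)]
          simp only [S, Set.mem_inter_iff, Set.mem_ofPred_eq, h, true_and, X, last]
        · rw [Set.indicator_of_notMem (mt hmem.1 h)]
          simp only [S, Set.mem_inter_iff, Set.mem_ofPred_eq, h, false_and, Set.ofPred_false,
            measure_empty]

theorem measure_belowLine_inter_belowLine_eq_lintegral (hW : IsBrownianReal W P) {σ τ : ℝ≥0}
    (hσ : σ ≠ 0) (hστ : σ ≤ τ) {a c A C : ℝ} (ha : 0 < a) (hlines : a + c * σ ≤ A + C * σ) :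
    P {ω | (W · ω) ∈ belowLine (Set.Icc 0 σ) a c ∩ belowLine (Set.Icc σ τ) A C} =
      ∫⁻ y in Set.Iio (a + c * σ), ENNReal.ofReal
        (stayBelowDensity a c σ y * bachelierLevy (A + C * σ - y) C √(τ - σ : ℝ≥0)) := by
  have := hW.isGaussianProcess.isProbabilityMeasure
  let Ψ : ℝ → ENNReal := fun y => P {ω | (fun r => W (σ + r) ω - W σ ω) ∈
    belowLine (Set.Icc 0 (τ - σ)) (A + C * σ - y) C}
  have hΨ : Measurable Ψ := by
    refine Antitone.measurable fun y y' hy => measure_mono fun ω hω r hr => ?_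
    exact (hω r hr).trans (by linarith)
  calc P {ω | (W · ω) ∈ belowLine (Set.Icc 0 σ) a c ∩ belowLine (Set.Icc σ τ) A C}
    _ = ∫⁻ ω in {ω | (W · ω) ∈ belowLine (Set.Icc 0 σ) a c}, Ψ (W σ ω) ∂P :=
        measure_belowLine_inter_belowLine hW hστ a c A C
    _ = ∫⁻ y in Set.Iio (a + c * σ), ENNReal.ofReal (stayBelowDensity a c σ y) * Ψ y := by
        rw [← lintegral_map' hΨ.aemeasurable (hW.aemeasurable σ).restrict,
          map_restrict_belowLine hW ha hσ, lintegral_withDensity_eq_lintegral_mul _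
            (continuous_stayBelowDensity a c σ).measurable.ennreal_ofReal hΨ]
        rfl
    _ = _ := by
        refine setLIntegral_congr_fun measurableSet_Iio fun y hy => ?_
        have hy' : y < a + c * σ := hy
        rw [ENNReal.ofReal_mul (stayBelowDensity_nonneg ha.le hσ hy'.le),
          ← measureReal_belowLine (hW.shift σ) (by linarith), ofReal_measureReal]

end TwoStage

section Representation

variable {Ω : Type*} [MeasurableSpace Ω] {P : Measure Ω} {B : ℝ≥0 → Ω → ℝ}

/-- The time change which turns the part of the Slepian process orthogonal to its initial value
into a Brownian motion. -/
def clock (τ : ℝ≥0) : ℝ≥0 := 2 * τ / (1 + τ)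

lemma coe_clock (τ : ℝ≥0) : (clock τ : ℝ) = 2 * τ / (1 + τ) := by
  simp [clock]

lemma continuous_clock : Continuous clock :=
  Continuous.div (by fun_prop) (by fun_prop) fun τ => by positivity

lemma clock_mono : Monotone clock := fun σ τ h => by
  rw [← NNReal.coe_le_coe, coe_clock, coe_clock, div_le_div_iff₀ (by positivity) (by positivity)]
  linarith [NNReal.coe_le_coe.2 h]

lemma clock_one : clock 1 = 1 := by
  ext
  rw [coe_clock]
  norm_num

lemma clock_le_one {τ : ℝ≥0} (hτ : τ ≤ 1) : clock τ ≤ 1 := (clock_mono hτ).trans_eq clock_one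

/-- The part of `slepian B (clock τ)` orthogonal to the initial value `slepian B 0`, normalised to
have variance `τ` for `τ ≤ 1`. -/
def innovation (B : ℝ≥0 → Ω → ℝ) (τ : ℝ≥0) (ω : Ω) : ℝ :=
  (1 + τ) / 2 * slepian B (clock τ) ω - (1 - τ) / 2 * slepian B 0 ω

/-- The innovation up to time `1`, continued by the increments of `B` after time `2` to a Brownian
motion on the whole half-line. -/
def drivingBM (B : ℝ≥0 → Ω → ℝ) (τ : ℝ≥0) (ω : Ω) : ℝ :=
  innovation B (min τ 1) ω + (B (max τ 1 + 1) ω - B 2 ω)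

lemma memLp_sub (hB : IsPreBrownianReal B P) (s t : ℝ≥0) :
    MemLp (fun ω => B s ω - B t ω) 2 P :=
  (hB.isGaussianProcess.hasGaussianLaw_eval s).memLp_two.sub
    (hB.isGaussianProcess.hasGaussianLaw_eval t).memLp_two

lemma memLp_slepian (hB : IsPreBrownianReal B P) (u : ℝ≥0) : MemLp (slepian B u) 2 P :=
  memLp_sub hB _ _

lemma memLp_innovation (hB : IsPreBrownianReal B P) (τ : ℝ≥0) : MemLp (innovation B τ) 2 P :=
  ((memLp_slepian hB _).const_mul _).sub ((memLp_slepian hB _).const_mul _)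

lemma memLp_drivingBM (hB : IsPreBrownianReal B P) (τ : ℝ≥0) : MemLp (drivingBM B τ) 2 P :=
  (memLp_innovation hB _).add (memLp_sub hB _ _)

lemma covariance_sub_sub (hB : IsPreBrownianReal B P) (s t s' t' : ℝ≥0) :
    cov[fun ω => B s ω - B t ω, fun ω => B s' ω - B t' ω; P] =
      min (s : ℝ) s' - min (s : ℝ) t' - min (t : ℝ) s' + min (t : ℝ) t' := by
  have := hB.isGaussianProcess.isProbabilityMeasure
  have h := fun t => (hB.isGaussianProcess.hasGaussianLaw_eval t).memLp_two
  rw [covariance_fun_sub_left (h _) (h _) (memLp_sub hB _ _),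
    covariance_fun_sub_right (h _) (h _) (h _), covariance_fun_sub_right (h _) (h _) (h _)]
  simp only [hB.covariance_eval, NNReal.coe_min]
  ring

lemma covariance_slepian (hB : IsPreBrownianReal B P) {u v : ℝ≥0} (huv : u ≤ v) (hv : v ≤ u + 1) :
    cov[slepian B u, slepian B v; P] = 1 - (v - u) := by
  have huv' : (u : ℝ) ≤ v := huv
  have hv' : (v : ℝ) ≤ u + 1 := hv
  refine (covariance_sub_sub hB _ _ _ _).trans ?_
  push_cast
  rw [min_eq_left (by linarith), min_eq_right hv', min_eq_left (by linarith), min_eq_left huv']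
  ring

lemma covariance_slepian_sub (hB : IsPreBrownianReal B P) {u s t : ℝ≥0} (hs : u + 1 ≤ s)
    (ht : u + 1 ≤ t) : cov[slepian B u, fun ω => B s ω - B t ω; P] = 0 := by
  have hs' : (u : ℝ) + 1 ≤ s := hs
  have ht' : (u : ℝ) + 1 ≤ t := ht
  refine (covariance_sub_sub hB _ _ _ _).trans ?_
  push_cast
  rw [min_eq_left hs', min_eq_left ht', min_eq_left (by linarith), min_eq_left (by linarith)]
  ring

lemma covariance_sub_sub_of_le (hB : IsPreBrownianReal B P) {r s t : ℝ≥0} (hrs : r ≤ s)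
    (hst : s ≤ t) :
    cov[fun ω => B s ω - B r ω, fun ω => B t ω - B r ω; P] = s - r := by
  have hrs' : (r : ℝ) ≤ s := hrs
  have hst' : (s : ℝ) ≤ t := hst
  rw [covariance_sub_sub hB, min_eq_left hst', min_eq_right hrs', min_eq_left (hrs'.trans hst'),
    min_self]
  ring

lemma covariance_innovation_right (hB : IsPreBrownianReal B P) {X : Ω → ℝ} (hX : MemLp X 2 P)
    (τ : ℝ≥0) :
    cov[X, innovation B τ; P] =
      (1 + τ) / 2 * cov[X, slepian B (clock τ); P] - (1 - τ) / 2 * cov[X, slepian B 0; P] := by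
  have := hB.isGaussianProcess.isProbabilityMeasure
  unfold innovation
  rw [covariance_fun_sub_right hX ((memLp_slepian hB _).const_mul _)
    ((memLp_slepian hB _).const_mul _), covariance_const_mul_right, covariance_const_mul_right]

lemma covariance_slepian_zero_innovation (hB : IsPreBrownianReal B P) {τ : ℝ≥0} (hτ : τ ≤ 1) :
    cov[slepian B 0, innovation B τ; P] = 0 := by
  rw [covariance_innovation_right hB (memLp_slepian hB 0),
    covariance_slepian hB zero_le (by simpa using clock_le_one hτ),
    covariance_slepian hB le_rfl zero_le, coe_clock, NNReal.coe_zero]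
  field_simp
  ring

lemma covariance_innovation (hB : IsPreBrownianReal B P) {σ τ : ℝ≥0} (hστ : σ ≤ τ) (hτ : τ ≤ 1) :
    cov[innovation B σ, innovation B τ; P] = σ := by
  have hτ' : clock τ ≤ 1 := clock_le_one hτ
  rw [covariance_innovation_right hB (memLp_innovation hB σ),
    covariance_comm _ (slepian B 0), covariance_slepian_zero_innovation hB (hστ.trans hτ),
    covariance_comm, covariance_innovation_right hB (memLp_slepian hB _),
    covariance_comm _ (slepian B (clock σ)), covariance_comm _ (slepian B 0),
    covariance_slepian hB (clock_mono hστ) (hτ'.trans le_add_self),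
    covariance_slepian hB zero_le (hτ'.trans le_add_self), coe_clock, coe_clock, NNReal.coe_zero]
  field_simp
  ring

lemma covariance_innovation_sub (hB : IsPreBrownianReal B P) {τ s t : ℝ≥0} (hτ : τ ≤ 1)
    (hs : 2 ≤ s) (ht : 2 ≤ t) : cov[innovation B τ, fun ω => B s ω - B t ω; P] = 0 := by
  have hclock : clock τ + 1 ≤ 2 := by
    rw [← one_add_one_eq_two]
    gcongr
    exact clock_le_one hτ
  have hzero : 0 + 1 ≤ (2 : ℝ≥0) := by norm_num
  rw [covariance_comm, covariance_innovation_right hB (memLp_sub hB _ _), covariance_comm,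
    covariance_slepian_sub hB (hclock.trans hs) (hclock.trans ht), covariance_comm,
    covariance_slepian_sub hB (hzero.trans hs) (hzero.trans ht)]
  ring

lemma two_le_max_one_add_one (τ : ℝ≥0) : 2 ≤ max τ 1 + 1 := by
  rw [← one_add_one_eq_two]
  gcongr
  exact le_max_right _ _

lemma covariance_drivingBM_right (hB : IsPreBrownianReal B P) {X : Ω → ℝ} (hX : MemLp X 2 P)
    (τ : ℝ≥0) :
    cov[X, drivingBM B τ; P] =
      cov[X, innovation B (min τ 1); P] + cov[X, fun ω => B (max τ 1 + 1) ω - B 2 ω; P] := by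
  have := hB.isGaussianProcess.isProbabilityMeasure
  exact covariance_add_right hX (memLp_innovation hB _) (memLp_sub hB _ _)

lemma covariance_slepian_zero_drivingBM (hB : IsPreBrownianReal B P) (τ : ℝ≥0) :
    cov[slepian B 0, drivingBM B τ; P] = 0 := by
  have hone : 0 + 1 ≤ (2 : ℝ≥0) := by norm_num
  rw [covariance_drivingBM_right hB (memLp_slepian hB 0),
    covariance_slepian_zero_innovation hB (min_le_right _ _),
    covariance_slepian_sub hB (hone.trans (two_le_max_one_add_one τ)) hone, add_zero]

lemma covariance_drivingBM (hB : IsPreBrownianReal B P) {σ τ : ℝ≥0} (hστ : σ ≤ τ) :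
    cov[drivingBM B σ, drivingBM B τ; P] = σ := by
  have h2 := two_le_max_one_add_one
  rw [covariance_drivingBM_right hB (memLp_drivingBM hB σ), covariance_comm,
    covariance_drivingBM_right hB (memLp_innovation hB _), covariance_comm (innovation B _),
    covariance_innovation hB (min_le_min_right _ hστ) (min_le_right _ _),
    covariance_innovation_sub hB (min_le_right _ _) (h2 σ) le_rfl, covariance_comm,
    covariance_drivingBM_right hB (memLp_sub hB _ _), covariance_comm,
    covariance_innovation_sub hB (min_le_right _ _) (h2 τ) le_rfl, covariance_comm,
    covariance_sub_sub_of_le hB (h2 σ) (by gcongr)]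
  push_cast
  linarith [min_add_max (σ : ℝ) 1]

lemma isGaussianProcess_slepian_zero_drivingBM (hB : IsPreBrownianReal B P) :
    IsGaussianProcess (Sum.elim (fun _ : Unit => slepian B 0) (drivingBM B)) P := by
  refine hB.isGaussianProcess.of_isGaussianProcess ?_
  rintro (_ | τ)
  · exact ⟨{0 + 1, 0},
      { toFun x := x ⟨0 + 1, by simp⟩ - x ⟨0, by simp⟩
        map_add' x y := by simp; ring
        map_smul' c x := by simp; ring }, fun ω => rfl⟩
  · let v : ℝ≥0 := min τ 1
    exact ⟨{clock v + 1, clock v, 0 + 1, 0, max τ 1 + 1, 2},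
      { toFun x := (1 + v) / 2 * (x ⟨clock v + 1, by simp⟩ - x ⟨clock v, by simp⟩)
          - (1 - v) / 2 * (x ⟨0 + 1, by simp⟩ - x ⟨0, by simp⟩)
          + (x ⟨max τ 1 + 1, by simp⟩ - x ⟨2, by simp⟩)
        map_add' x y := by simp only [Pi.add_apply]; ring
        map_smul' c x := by simp only [Pi.smul_apply, smul_eq_mul, RingHom.id_apply]; ring },
      fun ω => rfl⟩

lemma integral_sub_eq_zero (hB : IsPreBrownianReal B P) (s t : ℝ≥0) :
    ∫ ω, (B s ω - B t ω) ∂P = 0 := by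
  rw [integral_sub (hB.integrable_eval s) (hB.integrable_eval t), hB.integral_eval,
    hB.integral_eval, sub_zero]

lemma integral_drivingBM (hB : IsPreBrownianReal B P) (τ : ℝ≥0) : ∫ ω, drivingBM B τ ω ∂P = 0 := by
  have := hB.isGaussianProcess.isProbabilityMeasure
  have hslepian : ∀ u, Integrable (slepian B u) P := fun u =>
    (memLp_slepian hB u).integrable one_le_two
  have hslepian_zero : ∀ u, ∫ ω, slepian B u ω ∂P = 0 := fun u => integral_sub_eq_zero hB _ _
  have hinnovation : ∫ ω, innovation B (min τ 1) ω ∂P = 0 := by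
    unfold innovation
    rw [integral_sub ((hslepian _).const_mul _) ((hslepian _).const_mul _), integral_const_mul,
      integral_const_mul, hslepian_zero, hslepian_zero]
    ring
  unfold drivingBM
  rw [integral_add ((memLp_innovation hB _).integrable one_le_two)
    ((memLp_sub hB _ _).integrable one_le_two), hinnovation, integral_sub_eq_zero hB, add_zero]

theorem isBrownianReal_drivingBM (hB : IsBrownianReal B P) : IsBrownianReal (drivingBM B) P where
  toIsPreBrownianReal :=
    ((isGaussianProcess_slepian_zero_drivingBM
      hB.toIsPreBrownianReal).comp_right Sum.inr).isPreBrownianReal_of_covariance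
      (integral_drivingBM hB.toIsPreBrownianReal)
      fun _ _ => covariance_drivingBM hB.toIsPreBrownianReal
  cont := by
    filter_upwards [hB.cont] with ω hω
    have hclock := continuous_clock
    simp only [drivingBM, innovation, slepian]
    fun_prop

theorem indepFun_slepian_zero_drivingBM (hB : IsPreBrownianReal B P) :
    IndepFun (slepian B 0) (fun ω τ => drivingBM B τ ω) P := by
  have h := (isGaussianProcess_slepian_zero_drivingBM hB).indepFun_of_covariance_eq_zero
    (fun _ => (memLp_slepian hB 0).aemeasurable) (fun τ => (memLp_drivingBM hB τ).aemeasurable)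
    (fun _ τ => covariance_slepian_zero_drivingBM hB τ)
  exact h.comp (φ := fun x : Unit → ℝ => x ()) (by fun_prop) measurable_id

lemma hasLaw_slepian_zero (hB : IsPreBrownianReal B P) :
    HasLaw (slepian B 0) (gaussianReal 0 1) P := by
  have hslepian : slepian B 0 = fun ω => B 1 ω - B 0 ω := by
    ext
    simp [slepian]
  simpa [hslepian] using hasLaw_sub_of_le hB zero_le_one

end Representation

section Event

variable {Ω : Type*} {B : ℝ≥0 → Ω → ℝ} {ω : Ω}

/-- The inverse of `clock` on `[0, 1]`. -/
def unclock (u : ℝ≥0) : ℝ≥0 := u / (2 - u)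

lemma coe_unclock {u : ℝ≥0} (hu : u ≤ 1) : (unclock u : ℝ) = u / (2 - u) := by
  simp [unclock, NNReal.coe_sub (hu.trans one_le_two)]

lemma unclock_ne_zero {u : ℝ≥0} (h0 : 0 < u) (h1 : u ≤ 1) : unclock u ≠ 0 :=
  (div_pos h0 (tsub_pos_of_lt (h1.trans_lt one_lt_two))).ne'

lemma unclock_le_unclock {u v : ℝ≥0} (huv : u ≤ v) (hv : v ≤ 1) : unclock u ≤ unclock v :=
  div_le_div₀ zero_le huv (tsub_pos_of_lt (hv.trans_lt one_lt_two)) (tsub_le_tsub_left huv 2)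

lemma unclock_le_one {u : ℝ≥0} (hu : u ≤ 1) : unclock u ≤ 1 :=
  (unclock_le_unclock hu le_rfl).trans_eq (by ext; norm_num [coe_unclock])

lemma clock_unclock {u : ℝ≥0} (hu : u ≤ 1) : clock (unclock u) = u := by
  have h2 : (2 : ℝ) - u ≠ 0 := by linarith [NNReal.coe_le_one.2 hu]
  ext
  rw [coe_clock, coe_unclock hu]
  field_simp
  ring

lemma runningMax_le_iff_clock (hω : Continuous (B · ω)) {s : ℝ≥0} (hs : s ≤ 1) (m : ℝ) :
    runningMax B s ω ≤ m ↔ ∀ τ ≤ unclock s, slepian B (clock τ) ω ≤ m := by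
  have hslepian : Continuous fun u => slepian B u ω := by
    unfold slepian
    fun_prop
  rw [runningMax, csSup_le_iff (isCompact_Icc.image hslepian).bddAbove
    ((Set.nonempty_Icc.2 zero_le).image _), Set.forall_mem_image]
  refine ⟨fun h τ hτ => h ⟨zero_le, (clock_mono hτ).trans_eq (clock_unclock hs)⟩,
    fun h u hu => ?_⟩
  rw [← clock_unclock (hu.2.trans hs)]
  exact h _ (unclock_le_unclock hu.2 hs)

lemma slepian_clock_le_iff {τ : ℝ≥0} (hτ : τ ≤ 1) (m : ℝ) :
    slepian B (clock τ) ω ≤ m ↔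
      drivingBM B τ ω ≤ (m - slepian B 0 ω) / 2 + (m + slepian B 0 ω) / 2 * τ := by
  have hpos : (0 : ℝ) < (1 + τ) / 2 := by positivity
  have hdriving : drivingBM B τ ω =
      (1 + τ) / 2 * slepian B (clock τ) ω - (1 - τ) / 2 * slepian B 0 ω := by
    simp [drivingBM, innovation, min_eq_left hτ, max_eq_right hτ, one_add_one_eq_two]
  rw [hdriving, ← mul_le_mul_iff_right₀ hpos]
  constructor <;> intro h <;> linarith

/-- The paths which stay below the line `r ↦ (m - x) / 2 + (m + x) / 2 * r` on `[0, σ]`, and below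
the corresponding line for `M` on `[σ, τ]`. Given `slepian B 0 = x`, the running maxima are at most
`m` and `M` exactly when the path of `drivingBM B` is of this kind. -/
def belowLines (σ τ : ℝ≥0) (m M x : ℝ) : Set (ℝ≥0 → ℝ) :=
  belowLine (Set.Icc 0 σ) ((m - x) / 2) ((m + x) / 2) ∩
    belowLine (Set.Icc σ τ) ((M - x) / 2) ((M + x) / 2)

lemma measurableOnContinuous_belowLines (σ τ : ℝ≥0) (m M : ℝ) :
    MeasurableOnContinuous {z : ℝ × (ℝ≥0 → ℝ) | z.2 ∈ belowLines σ τ m M z.1} :=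
  (measurableOnContinuous_belowLine (a := fun x : ℝ => (m - x) / 2) (c := fun x => (m + x) / 2)
    _ (by fun_prop) (by fun_prop)).inter
  (measurableOnContinuous_belowLine (a := fun x : ℝ => (M - x) / 2) (c := fun x => (M + x) / 2)
    _ (by fun_prop) (by fun_prop))

lemma runningMax_le_and_le_iff (hω : Continuous (B · ω)) {s t : ℝ≥0} (hst : s ≤ t) (ht : t ≤ 1)
    {m M : ℝ} (hmM : m ≤ M) :
    runningMax B s ω ≤ m ∧ runningMax B t ω ≤ M ↔
      (drivingBM B · ω) ∈ belowLines (unclock s) (unclock t) m M (slepian B 0 ω) := by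
  have hle : unclock s ≤ unclock t := unclock_le_unclock hst ht
  have hone : ∀ {τ}, τ ≤ unclock t → τ ≤ 1 := fun h => h.trans (unclock_le_one ht)
  rw [runningMax_le_iff_clock hω (hst.trans ht), runningMax_le_iff_clock hω ht]
  refine ⟨fun ⟨hm, hM⟩ => ⟨fun τ hτ => ?_, fun τ hτ => ?_⟩, fun ⟨hm, hM⟩ => ?_⟩
  · exact (slepian_clock_le_iff (hone (hτ.2.trans hle)) m).1 (hm τ hτ.2)
  · exact (slepian_clock_le_iff (hone hτ.2) M).1 (hM τ hτ.2)
  · have hm' : ∀ τ ≤ unclock s, slepian B (clock τ) ω ≤ m := fun τ hτ =>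
      (slepian_clock_le_iff (hone (hτ.trans hle)) m).2 (hm τ ⟨zero_le, hτ⟩)
    refine ⟨hm', fun τ hτ => ?_⟩
    rcases le_total τ (unclock s) with h | h
    · exact (hm' τ h).trans hmM
    · exact (slepian_clock_le_iff (hone hτ) M).2 (hM τ ⟨h, hτ⟩)

end Event

section IteratedIntegral

variable {α β : Type*} {s : Set α} {t : α → Set β}

lemma indicator_setOf_fst_mem_and_snd_mem {E : Type*} [Zero E] (f : α × β → E) (x : α) (y : β) :
    {z : α × β | z.1 ∈ s ∧ z.2 ∈ t z.1}.indicator f (x, y) =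
      s.indicator (fun x => (t x).indicator (fun y => f (x, y)) y) x := by
  by_cases hx : x ∈ s <;> by_cases hy : y ∈ t x <;> simp [Set.indicator, hx, hy]

variable [MeasurableSpace α] [MeasurableSpace β] {μ : Measure α} {ν : Measure β}

lemma measurableSet_snd_of_mem (hst : MeasurableSet {z : α × β | z.1 ∈ s ∧ z.2 ∈ t z.1}) {x : α}
    (hx : x ∈ s) : MeasurableSet (t x) := by
  convert measurable_prodMk_left (x := x) hst using 1
  ext y
  simp [hx]

variable [SFinite ν]

lemma setLIntegral_prod_of_mem (hs : MeasurableSet s)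
    (hst : MeasurableSet {z : α × β | z.1 ∈ s ∧ z.2 ∈ t z.1}) {f : α × β → ENNReal}
    (hf : Measurable f) :
    ∫⁻ z in {z | z.1 ∈ s ∧ z.2 ∈ t z.1}, f z ∂μ.prod ν =
      ∫⁻ x in s, ∫⁻ y in t x, f (x, y) ∂ν ∂μ := by
  rw [← lintegral_indicator hst, lintegral_prod _ (hf.indicator hst).aemeasurable,
    ← lintegral_indicator hs]
  refine lintegral_congr fun x => ?_
  simp only [indicator_setOf_fst_mem_and_snd_mem]
  by_cases hx : x ∈ s
  · simp only [Set.indicator_of_mem hx, lintegral_indicator (measurableSet_snd_of_mem hst hx)]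
  · simp only [Set.indicator_of_notMem hx, lintegral_zero]

lemma setIntegral_prod_of_mem [SFinite μ] (hs : MeasurableSet s)
    (hst : MeasurableSet {z : α × β | z.1 ∈ s ∧ z.2 ∈ t z.1}) {f : α × β → ℝ}
    (hf : IntegrableOn f {z | z.1 ∈ s ∧ z.2 ∈ t z.1} (μ.prod ν)) :
    ∫ z in {z | z.1 ∈ s ∧ z.2 ∈ t z.1}, f z ∂μ.prod ν = ∫ x in s, ∫ y in t x, f (x, y) ∂ν ∂μ := by
  rw [← integral_indicator hst, integral_prod _ (hf.integrable_indicator hst),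
    ← integral_indicator hs]
  refine integral_congr_ae (ae_of_all _ fun x => ?_)
  simp only [indicator_setOf_fst_mem_and_snd_mem]
  by_cases hx : x ∈ s
  · simp only [Set.indicator_of_mem hx, integral_indicator (measurableSet_snd_of_mem hst hx)]
  · simp only [Set.indicator_of_notMem hx, integral_zero]

end IteratedIntegral

section JointDensity

variable {σ τ : ℝ≥0} {m M : ℝ}

/-- The joint density at `(x, y)` of a standard normal variable `X` and of the value at time `σ` of
an independent Brownian motion, on the event that its path lies in `belowLines σ τ m M X`. -/
def jointDensity (σ τ : ℝ≥0) (m M : ℝ) (z : ℝ × ℝ) : ℝ :=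
  gaussianPDFReal 0 1 z.1 * (stayBelowDensity ((m - z.1) / 2) ((m + z.1) / 2) σ z.2 *
    bachelierLevy ((M - z.1) / 2 + (M + z.1) / 2 * σ - z.2) ((M + z.1) / 2) √(τ - σ : ℝ≥0))

/-- The values `(x, y)` of `X` and of the Brownian motion at time `σ` which are compatible with
`belowLines σ τ m M x`. Outside this region `jointDensity` has no probabilistic meaning. -/
def densityRegion (σ : ℝ≥0) (m : ℝ) : Set (ℝ × ℝ) :=
  {z | z.1 ∈ Set.Iio m ∧ z.2 ∈ Set.Iio ((m - z.1) / 2 + (m + z.1) / 2 * σ)}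

lemma integrand_eq_jointDensity (hσ : σ ≠ 0) (x y : ℝ) :
    integrand σ ((σ - 1) / 2) ((σ + 1) / 2 * m) ((σ + 1) / 2 * M) √(τ - σ : ℝ≥0) m M x y =
      jointDensity σ τ m M (x, y) := by
  have hline : ∀ a : ℝ, ((σ : ℝ) - 1) / 2 * x + (σ + 1) / 2 * a = (a - x) / 2 + (a + x) / 2 * σ :=
    fun a => by ring
  have hsqrt : 2 * Real.pi * √(σ : ℝ) = √(2 * Real.pi) * √(2 * Real.pi * σ) := by
    rw [Real.sqrt_mul (x := 2 * Real.pi) (by positivity), ← mul_assoc,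
      Real.mul_self_sqrt (by positivity)]
  simp only [integrand, jointDensity, stayBelowDensity_eq hσ, gaussianPDFReal, hline, hsqrt,
    sub_zero, NNReal.coe_one, mul_one, one_div, mul_inv, neg_div,
    mul_div_cancel₀ (m - x) two_ne_zero]
  ring

lemma measurableSet_densityRegion : MeasurableSet (densityRegion σ m) :=
  (measurableSet_lt (by fun_prop) (by fun_prop)).inter
    (measurableSet_lt (by fun_prop) (by fun_prop))

lemma measurable_jointDensity : Measurable (jointDensity σ τ m M) := by
  have hPhi : Measurable Phi := (monotone_cdf _).measurable
  unfold jointDensity stayBelowDensity bachelierLevy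
  split_ifs <;> fun_prop

lemma jointDensity_nonneg (hσ : σ ≠ 0) (hmM : m ≤ M) {z : ℝ × ℝ} (hz : z ∈ densityRegion σ m) :
    0 ≤ jointDensity σ τ m M z := by
  obtain ⟨hx : z.1 < m, hy : z.2 < _⟩ := hz
  have hlines : (m - z.1) / 2 + (m + z.1) / 2 * σ ≤ (M - z.1) / 2 + (M + z.1) / 2 * σ := by gcongr
  exact mul_nonneg (gaussianPDFReal_nonneg _ _ _) (mul_nonneg
    (stayBelowDensity_nonneg (by linarith) hσ hy.le) (bachelierLevy_nonneg (by linarith) _ _))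

end JointDensity

section JointLaw

variable {Ω : Type*} [MeasurableSpace Ω] {P : Measure Ω} {W : ℝ≥0 → Ω → ℝ} {X : Ω → ℝ} {σ τ : ℝ≥0}
  {m M : ℝ}

lemma measure_belowLines_eq_lintegral (hW : IsBrownianReal W P) (hσ : σ ≠ 0) (hστ : σ ≤ τ)
    (hmM : m ≤ M) {x : ℝ} (hx : x < m) :
    gaussianPDF 0 1 x * P {ω | (W · ω) ∈ belowLines σ τ m M x} =
      ∫⁻ y in Set.Iio ((m - x) / 2 + (m + x) / 2 * σ),
        ENNReal.ofReal (jointDensity σ τ m M (x, y)) := by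
  unfold belowLines
  rw [measure_belowLine_inter_belowLine_eq_lintegral hW hσ hστ (by linarith) (by gcongr),
    ← lintegral_const_mul' _ _ gaussianPDF_ne_top]
  refine lintegral_congr fun y => ?_
  rw [gaussianPDF, ← ENNReal.ofReal_mul (gaussianPDFReal_nonneg _ _ _), jointDensity]

lemma measure_belowLines_of_lt (hW : IsPreBrownianReal W P) {x : ℝ} (hx : m < x) :
    P {ω | (W · ω) ∈ belowLines σ τ m M x} = 0 := by
  refine measure_eq_zero_iff_ae_notMem.2 ?_
  filter_upwards [hW.eval_zero_ae_eq_zero] with ω hω hmem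
  have hline := hmem.1 0 ⟨le_rfl, zero_le⟩
  simp only [hω, NNReal.coe_zero, mul_zero, add_zero] at hline
  linarith

theorem measure_belowLines_eq_setLIntegral (hW : IsBrownianReal W P)
    (hX : HasLaw X (gaussianReal 0 1) P) (hXW : IndepFun X (fun ω r => W r ω) P) (hσ : σ ≠ 0)
    (hστ : σ ≤ τ) (hmM : m ≤ M) :
    P {ω | (W · ω) ∈ belowLines σ τ m M (X ω)} =
      ∫⁻ z in densityRegion σ m, ENNReal.ofReal (jointDensity σ τ m M z) := by
  have := hW.isGaussianProcess.isProbabilityMeasure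
  have hS := measurableOnContinuous_belowLines σ τ m M
  let G : ℝ → ENNReal := fun x => P {ω | (W · ω) ∈ belowLines σ τ m M x}
  have hG : Measurable G := hS.measurable_measure_section hW.aemeasurable hW.cont
  calc P {ω | (W · ω) ∈ belowLines σ τ m M (X ω)}
    _ = ∫⁻ ω, G (X ω) ∂P :=
        hS.measure_preimage_of_indepFun hXW hX.aemeasurable hW.aemeasurable hW.cont
    _ = ∫⁻ x, gaussianPDF 0 1 x * G x := by
        rw [← lintegral_map' hG.aemeasurable hX.aemeasurable, hX.map_eq,
          gaussianReal_of_var_ne_zero _ one_ne_zero,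
          lintegral_withDensity_eq_lintegral_mul _ (measurable_gaussianPDF 0 1) hG]
        rfl
    _ = ∫⁻ x in Set.Iio m, gaussianPDF 0 1 x * G x := by
        rw [← lintegral_indicator measurableSet_Iio]
        refine lintegral_congr_ae ?_
        filter_upwards [Measure.ae_ne volume m] with x hxm
        rcases hxm.lt_or_gt with hx | hx
        · rw [Set.indicator_of_mem (Set.mem_Iio.2 hx)]
        · rw [Set.indicator_of_notMem (by simpa using hx.le)]
          simp only [G, measure_belowLines_of_lt hW.toIsPreBrownianReal hx, mul_zero]
    _ = ∫⁻ x in Set.Iio m, ∫⁻ y in Set.Iio ((m - x) / 2 + (m + x) / 2 * σ),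
          ENNReal.ofReal (jointDensity σ τ m M (x, y)) :=
        setLIntegral_congr_fun measurableSet_Iio fun x hx =>
          measure_belowLines_eq_lintegral hW hσ hστ hmM hx
    _ = _ :=
        (setLIntegral_prod_of_mem (t := fun x => Set.Iio ((m - x) / 2 + (m + x) / 2 * σ))
          measurableSet_Iio measurableSet_densityRegion
          measurable_jointDensity.ennreal_ofReal).symm

lemma ae_restrict_jointDensity_nonneg (hσ : σ ≠ 0) (hmM : m ≤ M) :
    0 ≤ᵐ[volume.restrict (densityRegion σ m)] jointDensity σ τ m M :=
  (ae_restrict_iff' measurableSet_densityRegion).2 <|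
    ae_of_all _ fun _ hz => jointDensity_nonneg hσ hmM hz

theorem integrableOn_jointDensity (hW : IsBrownianReal W P)
    (hX : HasLaw X (gaussianReal 0 1) P) (hXW : IndepFun X (fun ω r => W r ω) P) (hσ : σ ≠ 0)
    (hστ : σ ≤ τ) (hmM : m ≤ M) :
    IntegrableOn (jointDensity σ τ m M) (densityRegion σ m) := by
  have := hW.isGaussianProcess.isProbabilityMeasure
  rw [IntegrableOn, ← lintegral_ofReal_ne_top_iff_integrable
    measurable_jointDensity.aestronglyMeasurable (ae_restrict_jointDensity_nonneg hσ hmM),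
    ← measure_belowLines_eq_setLIntegral hW hX hXW hσ hστ hmM]
  exact measure_ne_top _ _

theorem measureReal_belowLines_eq_integral (hW : IsBrownianReal W P)
    (hX : HasLaw X (gaussianReal 0 1) P) (hXW : IndepFun X (fun ω r => W r ω) P) (hσ : σ ≠ 0)
    (hστ : σ ≤ τ) (hmM : m ≤ M) :
    P.real {ω | (W · ω) ∈ belowLines σ τ m M (X ω)} =
      ∫ x in Set.Iio m, ∫ y in Set.Iio ((m - x) / 2 + (m + x) / 2 * σ),
        jointDensity σ τ m M (x, y) := by
  rw [measureReal_def, measure_belowLines_eq_setLIntegral hW hX hXW hσ hστ hmM,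
    ← integral_eq_lintegral_of_nonneg_ae (ae_restrict_jointDensity_nonneg hσ hmM)
      measurable_jointDensity.aestronglyMeasurable]
  exact setIntegral_prod_of_mem (t := fun x => Set.Iio ((m - x) / 2 + (m + x) / 2 * σ))
    measurableSet_Iio measurableSet_densityRegion
    (integrableOn_jointDensity hW hX hXW hσ hστ hmM)

theorem setOf_runningMax_le_ae_eq {B : ℝ≥0 → Ω → ℝ} (hcont : ∀ᵐ ω ∂P, Continuous (B · ω))
    {s t : ℝ≥0} (hst : s ≤ t) (ht : t ≤ 1) (hmM : m ≤ M) :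
    {ω | runningMax B s ω ≤ m ∧ runningMax B t ω ≤ M} =ᵐ[P]
      {ω | (drivingBM B · ω) ∈ belowLines (unclock s) (unclock t) m M (slepian B 0 ω)} := by
  filter_upwards [hcont] with ω hω
  exact propext (runningMax_le_and_le_iff hω hst ht hmM)

end JointLaw

end Slepian

end

theorem theorem2 {Ω : Type*} [MeasurableSpace Ω] (P : Measure Ω)
    (B : ℝ≥0 → Ω → ℝ) (hB : IsBrownianReal B P)
    (s t : ℝ≥0) (hs : 0 < s) (hst : s ≤ t) (ht : t ≤ 1)
    (m M : ℝ) (hmM : m ≤ M)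
    (sbar T p q η δ : ℝ)
    (hsbar : sbar = (s : ℝ) / (2 - (s : ℝ))) (hT : T = (t : ℝ) / (2 - (t : ℝ)))
    (hp : p = (sbar - 1) / 2) (hq : q = (sbar + 1) / 2 * m) (hη : η = (sbar + 1) / 2 * M)
    (hδ : δ = Real.sqrt (T - sbar)) :
    NullMeasurableSet {ω | Slepian.runningMax B s ω ≤ m ∧ Slepian.runningMax B t ω ≤ M} P ∧
    IntegrableOn (fun z : ℝ × ℝ => Slepian.integrand sbar p q η δ m M z.1 z.2)
      {z : ℝ × ℝ | z.1 < m ∧ z.2 < p * z.1 + q} ∧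
    P.real {ω | Slepian.runningMax B s ω ≤ m ∧ Slepian.runningMax B t ω ≤ M} =
      ∫ x in Set.Iio m, ∫ y in Set.Iio (p * x + q),
        Slepian.integrand sbar p q η δ m M x y := by
  open Slepian in
  have hB' := hB.toIsPreBrownianReal
  have hW := isBrownianReal_drivingBM hB
  have hX := hasLaw_slepian_zero hB'
  have hXW := indepFun_slepian_zero_drivingBM hB'
  have hσ := unclock_ne_zero hs (hst.trans ht)
  have hστ := unclock_le_unclock hst ht
  have hsbar' : sbar = unclock s := hsbar.trans (coe_unclock (hst.trans ht)).symm
  have hδ' : δ = √(unclock t - unclock s : ℝ≥0) := by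
    rw [hδ, hT, hsbar', NNReal.coe_sub hστ, coe_unclock ht]
  have hline : ∀ x, p * x + q = (m - x) / 2 + (m + x) / 2 * unclock s := fun x => by
    rw [hp, hq, hsbar']
    ring
  have hintegrand : ∀ x y, integrand sbar p q η δ m M x y =
      jointDensity (unclock s) (unclock t) m M (x, y) := fun x y => by
    rw [hp, hq, hη, hδ', hsbar', integrand_eq_jointDensity hσ]
  have hevent := setOf_runningMax_le_ae_eq hB.cont hst ht hmM
  simp only [hintegrand, hline, measureReal_congr hevent]
  exact ⟨((measurableOnContinuous_belowLines _ _ m M).nullMeasurableSet_preimage hX.aemeasurable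
      hW.aemeasurable hW.cont).congr hevent.symm,
    integrableOn_jointDensity hW hX hXW hσ hστ hmM,
    measureReal_belowLines_eq_integral hW hX hXW hσ hστ hmM⟩
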